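/- **Conventions.** $G$ is a second countable compact Hausdorff group; unital $C^*$-algebras are nonzero; ideals are closed and two-sided; an action $\alpha\colon G\to\mathrm{Aut}(A)$ is continuous if $g\mapsto\alpha_g(a)$ is norm continuous for every $a\in A$. For a unital $C^*$-algebra $A$ put $A_\infty=\ell^\infty(\mathbb N,A)/c_0(\mathbb N,A)$ with quotient map $\kappa_A$, and let $A_\infty\cap A'$ be the relative commutant of (the constant sequences in) $A$. For a continuous action $\alpha$ of $G$ on $A$, let $\alpha_\infty$ be the entrywise action, let $\ell^\infty_\alpha(\mathbb N,A)$ be the set of those $a\in\ell^\infty(\mathbb N,A)$ for which $g\mapsto(\alpha_g(a_n))_n$ is continuous in the supremum norm, and let $A_{\infty,\alpha}=\kappa_A(\ell^\infty_\alpha(\mathbb N,A))$. Elements $a,b$ of a $C^*$-algebra are orthogonal if $ab=ba=a^*b=ab^*=0$, and a completely positive map has order zero if it preserves orthogonality. Let $\mathtt{Lt}_g(f)(x)=f(g^{-1}x)$ on $C(G)$. The *Rokhlin dimension* $\dim_{\mathrm{Rok}}(\alpha)\in\{0,1,2,\ldots,\infty\}$ is the least $d$ for which there are completely positive contractive order zero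 maps $\varphi_0,\dots,\varphi_d\colon C(G)\to A_{\infty,\alpha}\cap A'$, equivariant with respect to $\mathtt{Lt}$ and $\alpha_\infty$, with $\varphi_0(1)+\dots+\varphi_d(1)=1$ (and $\infty$ if there is no such $d$). The *Rokhlin dimension with commuting towers* $\dim^{\mathrm c}_{\mathrm{Rok}}(\alpha)$ is defined in the same way, requiring in addition that the ranges of $\varphi_0,\dots,\varphi_d$ commute pairwise. **Theorem.** Let $A$ be a unital $C^*$-algebra and let $\alpha\colon G\to\mathrm{Aut}(A)$ be a continuous action. 1. Let $\beta\colon G\to\mathrm{Aut}(B)$ be a continuous action on a unital $C^*$-algebra $B$, and let $A\otimes B$ be any $C^*$-completion of the algebraic tensor product of $A$ and $B$ on which the (continuous) tensor product action $g\mapsto\alpha_g\otimes\beta_g$ is defined. Then $$\dim_{\mathrm{Rok}}(\alpha\otimes\beta)\le\min\{\dim_{\mathrm{Rok}}(\alpha),\dim_{\mathrm{Rok}}(\beta)\},\qquad \dim^{\mathrm c}_{\mathrm{Rok}}(\alpha\otimes\beta)\le\min\{\dim^{\mathrm c}_{\mathrm{Rok}}(\alpha),\dim^{\mathrm c}_{\mathrm{Rok}}(\beta)\}.$$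 2. Let $I\subsetneq A$ be an $\alpha$-invariant ideal and let $\overline\alpha$ be the induced action of $G$ on $A/I$. Then $$\dim_{\mathrm{Rok}}(\overline\alpha)\le\dim_{\mathrm{Rok}}(\alpha),\qquad \dim^{\mathrm c}_{\mathrm{Rok}}(\overline\alpha)\le\dim^{\mathrm c}_{\mathrm{Rok}}(\alpha).$$ 3. Let $(A_n,\iota_n)_{n\in\mathbb N}$ be a direct system of unital $C^*$-algebras with unital connecting maps $\iota_n\colon A_n\to A_{n+1}$, and let $\alpha^{(n)}\colon G\to\mathrm{Aut}(A_n)$ be continuous actions with $\iota_n\circ\alpha^{(n)}_g=\alpha^{(n+1)}_g\circ\iota_n$ for all $n$ and all $g\in G$. Suppose that $A=\varinjlim A_n$ (the $C^*$-algebra direct limit), that $\alpha=\varinjlim\alpha^{(n)}$, and that $A$ is separable. Then $$\dim_{\mathrm{Rok}}(\alpha)\le\liminf_{n\to\infty}\dim_{\mathrm{Rok}}(\alpha^{(n)}),\qquad \dim^{\mathrm c}_{\mathrm{Rok}}(\alpha)\le\liminf_{n\to\infty}\dim^{\mathrm c}_{\mathrm{Rok}}(\alpha^{(n)}).$$ 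-/

import Mathlib

open scoped ENNReal TensorProduct Topology
open Filter

noncomputable section

namespace RokhlinDim

universe u v

/-! ## Quotients of C*-algebras by closed two-sided ideals -/

section Quotient

variable {A : Type u} [CStarAlgebra A] (I : Ideal A) [I.IsTwoSided]

/-- The closed `*`-subalgebra `{x ∈ I | x* ∈ I}`; it turns out to be all of `I`. -/
def selfAdjointPart : NonUnitalStarSubalgebra ℂ A where
  carrier := {x | x ∈ I ∧ star x ∈ I}
  add_mem' := by
    rintro x y ⟨hx, hx'⟩ ⟨hy, hy'⟩
    exact ⟨I.add_mem hx hy, by rw [star_add]; exact I.add_mem hx' hy'⟩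
  zero_mem' := ⟨I.zero_mem, by rw [star_zero]; exact I.zero_mem⟩
  mul_mem' := by
    rintro x y ⟨hx, hx'⟩ ⟨hy, hy'⟩
    exact ⟨I.mul_mem_left _ hy, by rw [star_mul]; exact I.mul_mem_left _ hx'⟩
  smul_mem' := by
    rintro c x ⟨hx, hx'⟩
    refine ⟨Submodule.smul_of_tower_mem I c hx, ?_⟩
    change star (c • x) ∈ I
    rw [star_smul]
    exact Submodule.smul_of_tower_mem I _ hx'
  star_mem' := by
    rintro x ⟨hx, hx'⟩
    exact ⟨hx', by rwa [star_star]⟩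

variable [hI : IsClosed (I : Set A)]

lemma isClosed_selfAdjointPart : IsClosed (selfAdjointPart I : Set A) := by
  have : (selfAdjointPart I : Set A) = (I : Set A) ∩ star ⁻¹' (I : Set A) := rfl
  rw [this]
  exact hI.inter (hI.preimage continuous_star)

lemma exists_approximateUnit : ∃ l : Filter A, l.NeBot ∧
    (∀ᶠ x in l, x ∈ I ∧ star x = x ∧ ‖1 - x‖ ≤ 1) ∧
    ∀ b ∈ I, star b ∈ I → Tendsto (fun x => b * x) l (𝓝 b) := by
  have := isClosed_selfAdjointPart I
  let _ : PartialOrder A := CStarAlgebra.spectralOrder A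
  have : StarOrderedRing A := CStarAlgebra.spectralOrderedRing A
  let _ : PartialOrder (selfAdjointPart I) := CStarAlgebra.spectralOrder _
  have : StarOrderedRing (selfAdjointPart I) := CStarAlgebra.spectralOrderedRing _
  have hl := CStarAlgebra.increasingApproximateUnit (selfAdjointPart I)
  refine ⟨(CStarAlgebra.approximateUnit (selfAdjointPart I)).map Subtype.val, inferInstance,
    ?_, ?_⟩
  · rw [eventually_map]
    filter_upwards [hl.eventually_nonneg, hl.eventually_norm, hl.eventually_star_eq] with x h0 h1 h2
    refine ⟨x.2.1, congrArg Subtype.val h2, ?_⟩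
    have h0' : (0 : A) ≤ (x : A) := by
      obtain ⟨y, hy⟩ := CStarAlgebra.nonneg_iff_eq_star_mul_self.1 h0
      rw [hy]
      exact star_mul_self_nonneg (y : A)
    have hx : (x : A) ∈ Set.Icc (0 : A) 1 := CStarAlgebra.mem_Icc_iff_norm_le_one.2 ⟨h0', h1⟩
    have : 1 - (x : A) ∈ Set.Icc (0 : A) 1 := Set.sub_mem_Icc_zero_iff_right.2 hx
    exact (CStarAlgebra.mem_Icc_iff_norm_le_one.1 this).2
  · intro b hb hb'
    rw [tendsto_map'_iff]
    exact (continuous_subtype_val.tendsto _).comp (hl.tendsto_mul_left ⟨b, hb, hb'⟩)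

lemma star_mem_of_mem {b : A} (hb : b ∈ I) : star b ∈ I := by
  obtain ⟨l, hl, h1, h2⟩ := exists_approximateUnit I
  have hbb : star b * b ∈ I := I.mul_mem_left _ hb
  have ht := h2 (star b * b) hbb (by simpa using hbb)
  have ht' : Tendsto (fun x => ‖star b * b - star b * b * x‖) l (𝓝 0) := by
    have := (tendsto_const_nhds (x := star b * b)).sub ht
    simpa using this.norm
  have hs : Tendsto (fun x => ‖star b - x * star b‖ * ‖star b - x * star b‖) l (𝓝 0) := by
    refine squeeze_zero' (Eventually.of_forall fun x => by positivity) ?_ ht'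
    filter_upwards [h1] with x hx
    rw [← CStarRing.norm_self_mul_star]
    have : (star b - x * star b) * star (star b - x * star b)
        = (1 - x) * (star b * b - star b * b * x) := by
      simp only [star_sub, star_star, star_mul, hx.2.1]
      noncomm_ring
    rw [this]
    refine (norm_mul_le _ _).trans ?_
    exact mul_le_of_le_one_left (norm_nonneg _) hx.2.2
  have hs' : Tendsto (fun x => x * star b) l (𝓝 (star b)) := by
    rw [tendsto_iff_norm_sub_tendsto_zero]
    have := (Real.continuous_sqrt.tendsto 0).comp hs
    simp only [Function.comp_def, Real.sqrt_mul_self (norm_nonneg _), Real.sqrt_zero] at this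
    simpa only [norm_sub_rev] using this
  refine hI.mem_of_tendsto hs' ?_
  filter_upwards [h1] with x hx
  exact I.mul_mem_right _ hx.1

lemma norm_mk_le (a : A) : ‖Ideal.Quotient.mk I a‖ ≤ ‖a‖ := Submodule.Quotient.norm_mk_le I a

lemma norm_mk_lt (x : A ⧸ I) {ε : ℝ} (hε : 0 < ε) :
    ∃ a : A, Ideal.Quotient.mk I a = x ∧ ‖a‖ < ‖x‖ + ε :=
  Submodule.Quotient.norm_mk_lt (S := I) x hε

lemma quotient_norm_mul_le (x y : A ⧸ I) : ‖x * y‖ ≤ ‖x‖ * ‖y‖ := by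
  have key : ∀ ε : ℝ, 0 < ε → ‖x * y‖ ≤ (‖x‖ + ε) * (‖y‖ + ε) := by
    intro ε hε
    obtain ⟨a, rfl, ha⟩ := norm_mk_lt I x hε
    obtain ⟨b, rfl, hb⟩ := norm_mk_lt I y hε
    rw [← map_mul]
    refine (norm_mk_le I _).trans ((norm_mul_le a b).trans ?_)
    gcongr
  have ht : Tendsto (fun ε : ℝ => (‖x‖ + ε) * (‖y‖ + ε)) (𝓝[>] 0) (𝓝 (‖x‖ * ‖y‖)) := by
    have : Continuous fun ε : ℝ => (‖x‖ + ε) * (‖y‖ + ε) := by fun_prop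
    simpa using (this.tendsto 0).mono_left nhdsWithin_le_nhds
  exact ge_of_tendsto ht (eventually_mem_nhdsWithin.mono fun ε hε => key ε hε)

/-- The quotient of a unital C*-algebra by a closed two-sided ideal, as a normed ring. -/
instance instNormedRingQuotient : NormedRing (A ⧸ I) :=
  { Ideal.Quotient.ring I, Submodule.Quotient.normedAddCommGroup I with
    norm_mul_le := quotient_norm_mul_le I }

/-- The involution `(a + I)* = a* + I`. -/
instance instStarRingQuotient : StarRing (A ⧸ I) where
  star := Quotient.map' star (by
    intro a b hab
    rw [Submodule.quotientRel_def] at hab ⊢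
    rw [← star_sub]
    exact star_mem_of_mem I hab)
  star_involutive := by
    rintro ⟨a⟩
    exact congrArg (Ideal.Quotient.mk I) (star_star a)
  star_mul := by
    rintro ⟨a⟩ ⟨b⟩
    exact congrArg (Ideal.Quotient.mk I) (star_mul a b)
  star_add := by
    rintro ⟨a⟩ ⟨b⟩
    exact congrArg (Ideal.Quotient.mk I) (star_add a b)

lemma star_mk (a : A) : star (Ideal.Quotient.mk I a) = Ideal.Quotient.mk I (star a) := rfl

lemma quotient_norm_star_mul_self (x : A ⧸ I) : ‖x‖ * ‖x‖ ≤ ‖star x * x‖ := by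
  obtain ⟨a, rfl⟩ := Ideal.Quotient.mk_surjective x
  rw [star_mk, ← map_mul]
  refine le_of_forall_pos_le_add fun ε hε => ?_
  obtain ⟨c, hc, hcn⟩ := norm_mk_lt I (Ideal.Quotient.mk I (star a * a)) hε
  have hb : c - star a * a ∈ I := Ideal.Quotient.eq.1 hc
  obtain ⟨l, hl, h1, h2⟩ := exists_approximateUnit I
  have ht := h2 _ hb (star_mem_of_mem I hb)
  have ht' : Tendsto (fun x => ‖c‖ + ‖(c - star a * a) - (c - star a * a) * x‖) l (𝓝 ‖c‖) := by
    have := (tendsto_const_nhds (x := c - star a * a)).sub ht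
    simpa using this.norm.const_add ‖c‖
  refine (ge_of_tendsto ht' ?_).trans hcn.le
  filter_upwards [h1] with x hx
  have e1 : Ideal.Quotient.mk I a = Ideal.Quotient.mk I (a * (1 - x)) := by
    rw [Ideal.Quotient.eq]
    have : a - a * (1 - x) = a * x := by noncomm_ring
    rw [this]
    exact I.mul_mem_left _ hx.1
  have e2 : star (a * (1 - x)) * (a * (1 - x))
      = (1 - x) * (c * (1 - x) - ((c - star a * a) - (c - star a * a) * x)) := by
    simp only [star_sub, star_mul, star_one, hx.2.1]
    noncomm_ring
  calc ‖Ideal.Quotient.mk I a‖ * ‖Ideal.Quotient.mk I a‖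
      ≤ ‖a * (1 - x)‖ * ‖a * (1 - x)‖ := by
        rw [e1]; gcongr <;> exact norm_mk_le I _
    _ = ‖(1 - x) * (c * (1 - x) - ((c - star a * a) - (c - star a * a) * x))‖ := by
        rw [← CStarRing.norm_star_mul_self, e2]
    _ ≤ 1 * ‖c * (1 - x) - ((c - star a * a) - (c - star a * a) * x)‖ :=
        (norm_mul_le _ _).trans (by gcongr; exact hx.2.2)
    _ ≤ ‖c * (1 - x)‖ + ‖(c - star a * a) - (c - star a * a) * x‖ := by
        rw [one_mul]; exact norm_sub_le _ _
    _ ≤ ‖c‖ + ‖(c - star a * a) - (c - star a * a) * x‖ := by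
        gcongr
        exact (norm_mul_le _ _).trans (mul_le_of_le_one_right (norm_nonneg _) hx.2.2)

/-- The quotient of a unital C*-algebra by a closed two-sided ideal, with the quotient norm,
is a unital C*-algebra. -/
instance instCStarAlgebraQuotient : CStarAlgebra (A ⧸ I) where
  norm_mul_self_le := quotient_norm_star_mul_self I
  toAlgebra := Ideal.Quotient.algebra ℂ
  norm_smul_le := (Submodule.Quotient.normedSpace I ℂ).norm_smul_le
  star_smul := by
    rintro c ⟨a⟩
    exact congrArg (Ideal.Quotient.mk I) (star_smul c a)

/-- The `*`-homomorphism `A/I → B/J` induced by a `*`-homomorphism `φ : A → B` with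
`φ(I) ⊆ J`. -/
def quotientMap {A : Type u} {B : Type v} [CStarAlgebra A] [CStarAlgebra B]
    (I : Ideal A) [I.IsTwoSided] [IsClosed (I : Set A)]
    (J : Ideal B) [J.IsTwoSided] [IsClosed (J : Set B)]
    (φ : A →⋆ₐ[ℂ] B) (h : ∀ a ∈ I, φ a ∈ J) : (A ⧸ I) →⋆ₐ[ℂ] (B ⧸ J) :=
  { Ideal.Quotient.liftₐ I ((Ideal.Quotient.mkₐ ℂ J).comp φ.toAlgHom)
      (fun a ha => Ideal.Quotient.eq_zero_iff_mem.2 (h a ha)) with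
    map_star' := by
      rintro ⟨a⟩
      exact congrArg (Ideal.Quotient.mk J) (map_star φ a) }

lemma quotientMap_mk {A : Type u} {B : Type v} [CStarAlgebra A] [CStarAlgebra B]
    (I : Ideal A) [I.IsTwoSided] [IsClosed (I : Set A)]
    (J : Ideal B) [J.IsTwoSided] [IsClosed (J : Set B)]
    (φ : A →⋆ₐ[ℂ] B) (h : ∀ a ∈ I, φ a ∈ J) (a : A) :
    quotientMap I J φ h (Ideal.Quotient.mk I a) = Ideal.Quotient.mk J (φ a) := rfl

end Quotient

/-! ## Continuous actions -/

/-- A continuous action of a topological group `G` on a C*-algebra `A`: a homomorphism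
`G → Aut(A)` such that `g ↦ α_g(a)` is norm continuous for every `a`. -/
structure CStarAction (G : Type v) [Group G] [TopologicalSpace G] (A : Type u) [CStarAlgebra A] where
  toAut : G →* (A ≃⋆ₐ[ℂ] A)
  continuous_apply : ∀ a : A, Continuous fun g => toAut g a

section Action

variable {G : Type v} [Group G] [TopologicalSpace G] {A : Type u} [CStarAlgebra A]

/-- The automorphism `α_g`, as a `*`-homomorphism. -/
def CStarAction.hom (α : CStarAction G A) (g : G) : A →⋆ₐ[ℂ] A :=
  { α.toAut g with
    map_one' := map_one (α.toAut g)
    map_zero' := map_zero (α.toAut g)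
    commutes' := fun c => by
      change α.toAut g (algebraMap ℂ A c) = _
      rw [Algebra.algebraMap_eq_smul_one, map_smul, map_one] }

lemma CStarAction.hom_apply (α : CStarAction G A) (g : G) (a : A) : α.hom g a = α.toAut g a := rfl

/-- The action induced on `A/I` by an action `α` on `A` and an `α`-invariant closed ideal `I`,
`g ↦ (a + I ↦ α_g(a) + I)`. -/
def CStarAction.quotient (α : CStarAction G A) (I : Ideal A) [I.IsTwoSided]
    [IsClosed (I : Set A)] (h : ∀ g, ∀ a ∈ I, α.toAut g a ∈ I) : CStarAction G (A ⧸ I) where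
  toAut :=
    { toFun := fun g =>
        { toFun := quotientMap I I (α.hom g) (h g)
          invFun := quotientMap I I (α.hom g⁻¹) (h g⁻¹)
          left_inv := by
            intro x
            obtain ⟨a, rfl⟩ := Ideal.Quotient.mk_surjective x
            change Ideal.Quotient.mk I ((α.toAut g⁻¹ * α.toAut g) a) = Ideal.Quotient.mk I a
            rw [← map_mul, inv_mul_cancel, map_one]
            rfl
          right_inv := by
            intro x
            obtain ⟨a, rfl⟩ := Ideal.Quotient.mk_surjective x
            change Ideal.Quotient.mk I ((α.toAut g * α.toAut g⁻¹) a) = Ideal.Quotient.mk I a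
            rw [← map_mul, mul_inv_cancel, map_one]
            rfl
          map_mul' := map_mul _
          map_add' := map_add _
          map_star' := map_star _
          map_smul' := map_smul _ }
      map_one' := by
        ext x
        obtain ⟨a, rfl⟩ := Ideal.Quotient.mk_surjective x
        change Ideal.Quotient.mk I (α.toAut 1 a) = Ideal.Quotient.mk I a
        rw [map_one]
        rfl
      map_mul' := by
        intro g k
        ext x
        obtain ⟨a, rfl⟩ := Ideal.Quotient.mk_surjective x
        change Ideal.Quotient.mk I (α.toAut (g * k) a) =
          Ideal.Quotient.mk I (α.toAut g (α.toAut k a))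
        rw [map_mul]
        rfl }
  continuous_apply := by
    intro x
    obtain ⟨a, rfl⟩ := Ideal.Quotient.mk_surjective x
    have hc : Continuous (Ideal.Quotient.mk I) :=
      AddMonoidHomClass.continuous_of_bound (Ideal.Quotient.mk I) 1
        fun a => by simpa using norm_mk_le I a
    exact hc.comp (α.continuous_apply a)

end Action

/-! ## Sequence algebras

Unital C*-algebras are nonzero, hence the assumption `Nontrivial A` from here on. -/

section Sequences

/-- `ℓ^∞(ℕ, A)`. -/
abbrev BoundedSeq (A : Type u) [CStarAlgebra A] : Type u := lp (fun _ : ℕ => A) ∞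

instance instCStarAlgebraBoundedSeq (A : Type u) [CStarAlgebra A] [Nontrivial A] :
    CStarAlgebra (BoundedSeq A) where

variable {A : Type u} [CStarAlgebra A] [Nontrivial A]

/-- `ℓ^∞(ℕ, φ)` for a `*`-homomorphism `φ : A → B`: apply `φ` in each entry. -/
def seqMap {B : Type v} [CStarAlgebra B] [Nontrivial B] (φ : A →⋆ₐ[ℂ] B) :
    BoundedSeq A →⋆ₐ[ℂ] BoundedSeq B where
  toFun x := ⟨fun n => φ (x n), by
    refine memℓp_infty ⟨‖x‖, ?_⟩
    rintro _ ⟨n, rfl⟩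
    exact (NonUnitalStarAlgHom.norm_apply_le φ (x n)).trans (lp.norm_apply_le_norm (by simp) x n)⟩
  map_one' := by ext n; exact map_one φ
  map_mul' x y := by ext n; exact map_mul φ _ _
  map_zero' := by ext n; exact map_zero φ
  map_add' x y := by ext n; exact map_add φ _ _
  commutes' c := by ext n; exact AlgHomClass.commutes φ c
  map_star' x := by ext n; exact map_star φ _

lemma seqMap_apply {B : Type v} [CStarAlgebra B] [Nontrivial B] (φ : A →⋆ₐ[ℂ] B)
    (x : BoundedSeq A) (n : ℕ) : seqMap φ x n = φ (x n) := rfl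

variable (A) in
/-- `c_0(ℕ, A)`, as an ideal of `ℓ^∞(ℕ, A)`. -/
def nullSeq : Ideal (BoundedSeq A) where
  carrier := {x | Tendsto (fun n => ‖x n‖) atTop (𝓝 0)}
  add_mem' := by
    intro x y hx hy
    refine squeeze_zero (fun n => norm_nonneg _) (fun n => ?_) (by simpa using hx.add hy)
    exact norm_add_le (x n) (y n)
  zero_mem' := by
    change Tendsto (fun n => ‖((0 : BoundedSeq A) : ℕ → A) n‖) atTop (𝓝 0)
    simp
  smul_mem' := by
    intro c x hx
    refine squeeze_zero (fun n => norm_nonneg _) (fun n => ?_)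
      (by simpa using Tendsto.const_mul ‖c‖ hx)
    refine (norm_mul_le (c n) (x n)).trans ?_
    gcongr
    exact lp.norm_apply_le_norm (by simp) c n

lemma mem_nullSeq {x : BoundedSeq A} :
    x ∈ nullSeq A ↔ Tendsto (fun n => ‖x n‖) atTop (𝓝 0) := Iff.rfl

instance : (nullSeq A).IsTwoSided where
  mul_mem_of_left := by
    intro x c hx
    refine squeeze_zero (fun n => norm_nonneg _) (fun n => ?_)
      (by simpa using Tendsto.mul_const ‖c‖ hx)
    refine (norm_mul_le (x n) (c n)).trans ?_
    gcongr
    exact lp.norm_apply_le_norm (by simp) c n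

instance : IsClosed (nullSeq A : Set (BoundedSeq A)) := by
  refine isClosed_of_closure_subset fun x hx => ?_
  change Tendsto (fun n => ‖x n‖) atTop (𝓝 0)
  rw [Metric.tendsto_atTop]
  intro ε hε
  obtain ⟨y, hy, hxy⟩ := Metric.mem_closure_iff.1 hx (ε / 2) (half_pos hε)
  obtain ⟨N, hN⟩ := Metric.tendsto_atTop.1 (mem_nullSeq.1 hy) (ε / 2) (half_pos hε)
  refine ⟨N, fun n hn => ?_⟩
  have h1 := hN n hn
  simp only [dist_zero_right, norm_norm] at h1 ⊢
  rw [dist_eq_norm] at hxy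
  have h2 : ‖x n - y n‖ ≤ ‖x - y‖ := lp.norm_apply_le_norm (by simp) (x - y) n
  calc ‖x n‖ = ‖(x n - y n) + y n‖ := by rw [sub_add_cancel]
    _ ≤ ‖x n - y n‖ + ‖y n‖ := norm_add_le _ _
    _ < ε := by linarith

variable (A) in
/-- The sequence algebra `A_∞ = ℓ^∞(ℕ, A) / c_0(ℕ, A)`. -/
abbrev SeqAlg : Type u := BoundedSeq A ⧸ nullSeq A

variable (A) in
/-- The quotient map `κ_A : ℓ^∞(ℕ, A) → A_∞`. -/
def kappa : BoundedSeq A →⋆ₐ[ℂ] SeqAlg A :=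
  { Ideal.Quotient.mkₐ ℂ (nullSeq A) with
    map_star' := fun _ => rfl }

/-- The homomorphism `φ_∞ : A_∞ → B_∞` induced by `φ : A → B`. -/
def seqAlgMap {B : Type v} [CStarAlgebra B] [Nontrivial B] (φ : A →⋆ₐ[ℂ] B) :
    SeqAlg A →⋆ₐ[ℂ] SeqAlg B :=
  quotientMap (nullSeq A) (nullSeq B) (seqMap φ) (by
    intro x hx
    exact squeeze_zero (fun n => norm_nonneg _)
      (fun n => NonUnitalStarAlgHom.norm_apply_le φ (x n)) hx)

/-- The constant sequence with value `a`. -/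
def constSeq (a : A) : BoundedSeq A :=
  ⟨fun _ => a, memℓp_infty ⟨‖a‖, by rintro _ ⟨n, rfl⟩; exact le_rfl⟩⟩

variable {G : Type v} [Group G] [TopologicalSpace G]

/-- `ℓ^∞_α(ℕ, A)`: the bounded sequences `a` for which `g ↦ (α_g(a_n))_n` is continuous
in the supremum norm. -/
def contSeq (α : CStarAction G A) : StarSubalgebra ℂ (BoundedSeq A) where
  carrier := {a | Continuous fun g => seqMap (α.hom g) a}
  mul_mem' := by
    intro a b ha hb
    change Continuous fun g => seqMap (α.hom g) (a * b)
    simp only [map_mul]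
    exact Continuous.mul ha hb
  add_mem' := by
    intro a b ha hb
    change Continuous fun g => seqMap (α.hom g) (a + b)
    simp only [map_add]
    exact Continuous.add ha hb
  algebraMap_mem' := by
    intro c
    change Continuous fun g => seqMap (α.hom g) (algebraMap ℂ (BoundedSeq A) c)
    simp only [AlgHomClass.commutes]
    exact continuous_const
  star_mem' := by
    intro a ha
    change Continuous fun g => seqMap (α.hom g) (star a)
    simp only [map_star]
    exact Continuous.star ha

/-- `A_{∞,α} = κ_A(ℓ^∞_α(ℕ, A))`. -/
def contSeqAlg (α : CStarAction G A) : StarSubalgebra ℂ (SeqAlg A) := (contSeq α).map (kappa A)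

variable (A) in
/-- The relative commutant `A_∞ ∩ A'` of (the image of) `A` in `A_∞`. -/
def relCommutant : StarSubalgebra ℂ (SeqAlg A) :=
  StarSubalgebra.centralizer ℂ (Set.range fun a : A => kappa A (constSeq a))

end Sequences

/-! ## Order zero maps and Rokhlin dimension -/

section OrderZero

variable {A : Type u} {B : Type v} [CStarAlgebra A] [CStarAlgebra B]

/-- Orthogonality: `ab = ba = a*b = ab* = 0`. -/
def Orthogonal (a b : A) : Prop := a * b = 0 ∧ b * a = 0 ∧ star a * b = 0 ∧ a * star b = 0

/-- Complete positivity, with respect to the orders given by the cones of positive elements. -/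
def IsCompletelyPositive (φ : A →ₗ[ℂ] B) : Prop :=
  letI : PartialOrder A := CStarAlgebra.spectralOrder A
  haveI : StarOrderedRing A := CStarAlgebra.spectralOrderedRing A
  letI : PartialOrder B := CStarAlgebra.spectralOrder B
  haveI : StarOrderedRing B := CStarAlgebra.spectralOrderedRing B
  ∃ ψ : CompletelyPositiveMap A B, ψ.toLinearMap = φ

/-- Completely positive contractive order zero maps. -/
structure IsCPCOrderZero (φ : A →ₗ[ℂ] B) : Prop where
  completelyPositive : IsCompletelyPositive φ
  contractive : ∀ a, ‖φ a‖ ≤ ‖a‖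
  orderZero : ∀ a b, Orthogonal a b → Orthogonal (φ a) (φ b)

end OrderZero

section Rokhlin

variable {G : Type v} [Group G] [TopologicalSpace G] [IsTopologicalGroup G]

/-- Left translation on `C(G)`: `Lt_g(f)(x) = f(g⁻¹x)`. -/
def leftTranslate (g : G) (f : C(G, ℂ)) : C(G, ℂ) :=
  f.comp ⟨fun x => g⁻¹ * x, continuous_const_mul g⁻¹⟩

variable [CompactSpace G] {A : Type u} [CStarAlgebra A] [Nontrivial A]

/-- The maps `φ_0, …, φ_d : C(G) → A_{∞,α} ∩ A'` are equivariant, completely positive contractive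
and of order zero, and `φ_0(1) + … + φ_d(1) = 1`. (Positivity, norms and orthogonality in the
C*-subalgebra `A_{∞,α} ∩ A'` are those of `A_∞`.) -/
structure IsRokhlinSystem (α : CStarAction G A) {d : ℕ}
    (φ : Fin (d + 1) → C(G, ℂ) →ₗ[ℂ] SeqAlg A) : Prop where
  mem : ∀ j f, φ j f ∈ contSeqAlg α ⊓ relCommutant A
  cpcOrderZero : ∀ j, IsCPCOrderZero (φ j)
  equivariant : ∀ j g f, φ j (leftTranslate g f) = seqAlgMap (α.hom g) (φ j f)
  sum_one : ∑ j, φ j 1 = 1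

/-- The Rokhlin dimension of `α`: the least `d` for which there are `φ_0, …, φ_d` as above,
and `∞` if there is none. -/
def dimRok (α : CStarAction G A) : ℕ∞ :=
  sInf {n : ℕ∞ | ∃ d : ℕ, n = d ∧
    ∃ φ : Fin (d + 1) → C(G, ℂ) →ₗ[ℂ] SeqAlg A, IsRokhlinSystem α φ}

/-- The Rokhlin dimension of `α` with commuting towers: the least `d` for which there are
`φ_0, …, φ_d` as above with pairwise commuting ranges, and `∞` if there is none. -/
def dimRokComm (α : CStarAction G A) : ℕ∞ :=
  sInf {n : ℕ∞ | ∃ d : ℕ, n = d ∧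
    ∃ φ : Fin (d + 1) → C(G, ℂ) →ₗ[ℂ] SeqAlg A, IsRokhlinSystem α φ ∧
      ∀ j k, j ≠ k → ∀ f h, Commute (φ j f) (φ k h)}

end Rokhlin

/-! ## Tensor products and direct limits -/

section Constructions

universe w

variable {G : Type*} [Group G] [TopologicalSpace G]

/-- `C`, together with `j : A ⊙ B → C`, is a C*-completion of the algebraic tensor product
(that is, the completion for the C*-norm `x ↦ ‖j x‖`), and `γ` is the tensor product action
`γ_g = α_g ⊗ β_g` on it. -/
structure IsTensorProductAction {A : Type u} {B : Type v} {C : Type w} [CStarAlgebra A]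
    [CStarAlgebra B] [CStarAlgebra C] (α : CStarAction G A) (β : CStarAction G B)
    (γ : CStarAction G C) (j : A ⊗[ℂ] B →⋆ₐ[ℂ] C) : Prop where
  injective : Function.Injective j
  denseRange : DenseRange j
  apply_tmul : ∀ g a b, γ.toAut g (j (a ⊗ₜ[ℂ] b)) = j (α.toAut g a ⊗ₜ[ℂ] β.toAut g b)

/-- The connecting map `A_n → A_{n+k}` of the direct system `ι_n : A_n → A_{n+1}`. -/
def connect {A : ℕ → Type v} [∀ n, CStarAlgebra (A n)] (ι : ∀ n, A n →⋆ₐ[ℂ] A (n + 1)) (n : ℕ) :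
    ∀ k : ℕ, A n →⋆ₐ[ℂ] A (n + k)
  | 0 => StarAlgHom.id ℂ (A n)
  | k + 1 => (ι (n + k)).comp (connect ι n k)

/-- `L`, with the canonical maps `ι_{n,∞} : A_n → L`, is the C*-algebra direct limit of the direct
system `(A_n, ι_n)`: the maps are compatible, the union of their ranges is dense, and
`‖ι_{n,∞}(a)‖ = lim_k ‖ι_{n,n+k}(a)‖`. Equivalently, `L` is the completion of the algebraic
direct limit in the limit seminorm. -/
structure IsCStarDirectLimit {A : ℕ → Type v} [∀ n, CStarAlgebra (A n)]
    (ι : ∀ n, A n →⋆ₐ[ℂ] A (n + 1)) {L : Type u} [CStarAlgebra L]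
    (ιInf : ∀ n, A n →⋆ₐ[ℂ] L) : Prop where
  compatible : ∀ n a, ιInf (n + 1) (ι n a) = ιInf n a
  dense : Dense (⋃ n, Set.range (ιInf n))
  norm : ∀ n a, Tendsto (fun k => ‖connect ι n k a‖) atTop (𝓝 ‖ιInf n a‖)

end Constructions

end RokhlinDim

end

open RokhlinDim

/-!
The three estimates transport Rokhlin systems, that is tuples of equivariant completely positive
contractive order zero maps `C(G) → A_{∞,α} ∩ A'` whose values at `1` add up to `1`.

*Tensor products and quotients.* An equivariant unital `*`-homomorphism `π : A → B` induces
`π_∞ : A_∞ → B_∞`, which maps `A_{∞,α}` into `B_{∞,β}`. If it also maps `A_∞ ∩ A'` into `B_∞ ∩ B'`,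
then `π_∞ ∘ φ_j` is a Rokhlin system for `B` (`IsRokhlinSystem.map`). This applies to the factor
embeddings `a ↦ a ⊗ 1` and `b ↦ 1 ⊗ b`, because elementary tensors span a dense subspace, and to
quotient maps, because they are surjective.

*Direct limits.* If the limit inferior is finite, then by the pigeonhole principle there are systems
with one fixed number of towers for infinitely many of the actions `α^{(n)}`. Their images in `A_∞`
are equivariant order zero maps `ψ_k`, and these commute with more and more of `A`. Together they
define order zero maps into `(A_∞)_∞`, the quotient of the C*-algebra of bounded double sequences,
which commute with all of `A`. It remains to return from `(A_∞)_∞` to `A_∞`. For `m : ℕ → ℕ` the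
diagonal `(x_{k,n}) ↦ (x_{k,m(k)})` is a `*`-homomorphism on bounded double sequences, and on a
given separable subalgebra `m` can be chosen such that it does not increase the quotient norms
(`exists_diagonal`); hence it descends to a `*`-homomorphism from the image of that subalgebra in
`(A_∞)_∞` to `A_∞` (`exists_transfer`), and order zero maps, commutation relations and the sum
condition are carried along. No liftings of completely positive maps are needed, because complete
positivity can be tested after an injective `*`-homomorphism
(`IsCompletelyPositive.of_forall_comp`).

The values of the resulting maps have to lie in `A_{∞,α}`, not only in `A_∞`. By equivariance, the
lift of `ψ_k(f)` moves under `g` by at most `‖g · f - f‖`, up to a small error, in all entries far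
enough out; compactness of `G` makes this uniform in `g`
(`eventually_forall_norm_hom_sub_le`). So `m` can be chosen such that the diagonals are
equicontinuous for a dense sequence of functions `f`, and closedness of `A_{∞,α}`
(`isClosed_contSeqAlg`) gives the general case.
-/

noncomputable section

namespace RokhlinDim

universe u v w

/-! ### Completely positive order zero maps and `*`-homomorphisms -/

section CompletelyPositive

/-- A jointly injective family of `*`-homomorphisms reflects positivity: it detects
self-adjointness and, since it commutes with the functional calculus, vanishing of the negative
part. -/
lemma nonneg_of_forall_map_nonneg {ι : Type*} {A : Type*} {B : ι → Type*}
    [NonUnitalCStarAlgebra A] [PartialOrder A] [StarOrderedRing A]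
    [∀ i, NonUnitalCStarAlgebra (B i)] [∀ i, PartialOrder (B i)] [∀ i, StarOrderedRing (B i)]
    (π : ∀ i, A →⋆ₙₐ[ℂ] B i) (hπ : ∀ a, (∀ i, π i a = 0) → a = 0) {a : A}
    (ha : ∀ i, 0 ≤ π i a) : 0 ≤ a := by
  have hsa : IsSelfAdjoint a := by
    rw [isSelfAdjoint_iff, ← sub_eq_zero]
    refine hπ _ fun i => ?_
    rw [map_sub, map_star, (IsSelfAdjoint.of_nonneg (ha i)).star_eq, sub_self]
  rw [← CFC.negPart_eq_zero_iff a]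
  refine hπ _ fun i => ?_
  have h := (CFC.negPart_eq_zero_iff (π i a) (IsSelfAdjoint.of_nonneg (ha i))).2 (ha i)
  rw [CFC.negPart_def] at h ⊢
  rw [← h]
  exact NonUnitalStarAlgHomClass.map_cfcₙ (S := ℂ) (π i) _ a
    (hφ := map_continuous (π i)) (hφa := IsSelfAdjoint.of_nonneg (ha i))

variable {A : Type u} {B : Type v} {C : Type w} [CStarAlgebra A] [CStarAlgebra B] [CStarAlgebra C]

lemma IsCompletelyPositive.comp_starAlgHom {φ : A →ₗ[ℂ] B} (h : IsCompletelyPositive φ)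
    (π : B →⋆ₐ[ℂ] C) : IsCompletelyPositive (π.toAlgHom.toLinearMap ∘ₗ φ) := by
  let _ : PartialOrder A := CStarAlgebra.spectralOrder A
  have : StarOrderedRing A := CStarAlgebra.spectralOrderedRing A
  let _ : PartialOrder B := CStarAlgebra.spectralOrder B
  have : StarOrderedRing B := CStarAlgebra.spectralOrderedRing B
  let _ : PartialOrder C := CStarAlgebra.spectralOrder C
  have : StarOrderedRing C := CStarAlgebra.spectralOrderedRing C
  obtain ⟨ψ, rfl⟩ := h
  exact ⟨{ (π.toAlgHom.toLinearMap ∘ₗ ψ.toLinearMap : A →ₗ[ℂ] C) with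
    map_cstarMatrix_nonneg' := fun k M hM =>
      CompletelyPositiveMapClass.map_cstarMatrix_nonneg' π k _
        (ψ.map_cstarMatrix_nonneg' k M hM) }, rfl⟩

lemma IsCompletelyPositive.of_forall_comp {ι : Type*} {C : ι → Type w} [∀ i, CStarAlgebra (C i)]
    {φ : A →ₗ[ℂ] B} (π : ∀ i, B →⋆ₐ[ℂ] C i) (hπ : ∀ b, (∀ i, π i b = 0) → b = 0)
    (h : ∀ i, IsCompletelyPositive ((π i).toAlgHom.toLinearMap ∘ₗ φ)) :
    IsCompletelyPositive φ := by
  let _ : PartialOrder A := CStarAlgebra.spectralOrder A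
  have : StarOrderedRing A := CStarAlgebra.spectralOrderedRing A
  let _ : PartialOrder B := CStarAlgebra.spectralOrder B
  have : StarOrderedRing B := CStarAlgebra.spectralOrderedRing B
  let _ : ∀ i, PartialOrder (C i) := fun i => CStarAlgebra.spectralOrder (C i)
  have : ∀ i, StarOrderedRing (C i) := fun i => CStarAlgebra.spectralOrderedRing (C i)
  refine ⟨{ φ with map_cstarMatrix_nonneg' := fun k M hM => ?_ }, rfl⟩
  refine nonneg_of_forall_map_nonneg
    (fun i => CStarMatrix.mapₙₐ (n := Fin k) ((π i : B →⋆ₐ[ℂ] C i) : B →⋆ₙₐ[ℂ] C i))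
    (fun N hN => ?_) fun i => ?_
  · ext a b
    exact hπ _ fun i => congrFun (congrFun (hN i) a) b
  · obtain ⟨ψ, hψ⟩ := h i
    have := ψ.map_cstarMatrix_nonneg' k M hM
    rw [hψ] at this
    exact this

lemma Orthogonal.map {a b : A} (h : Orthogonal a b) (π : A →⋆ₐ[ℂ] B) :
    Orthogonal (π a) (π b) := by
  obtain ⟨h1, h2, h3, h4⟩ := h
  refine ⟨?_, ?_, ?_, ?_⟩ <;> simp only [← map_star, ← map_mul, h1, h2, h3, h4, map_zero]

lemma orthogonal_of_forall_map {ι : Type*} {C : ι → Type w} [∀ i, CStarAlgebra (C i)]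
    (π : ∀ i, B →⋆ₐ[ℂ] C i) (hπ : ∀ b, (∀ i, π i b = 0) → b = 0) {a b : B}
    (h : ∀ i, Orthogonal (π i a) (π i b)) : Orthogonal a b := by
  refine ⟨hπ _ fun i => ?_, hπ _ fun i => ?_, hπ _ fun i => ?_, hπ _ fun i => ?_⟩ <;>
    simp only [map_mul, map_star]
  exacts [(h i).1, (h i).2.1, (h i).2.2.1, (h i).2.2.2]

lemma IsCPCOrderZero.comp_starAlgHom {φ : A →ₗ[ℂ] B} (h : IsCPCOrderZero φ)
    (π : B →⋆ₐ[ℂ] C) : IsCPCOrderZero (π.toAlgHom.toLinearMap ∘ₗ φ) where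
  completelyPositive := h.completelyPositive.comp_starAlgHom π
  contractive a := (NonUnitalStarAlgHom.norm_apply_le π (φ a)).trans (h.contractive a)
  orderZero a b hab := (h.orderZero a b hab).map π

/-- Being completely positive, contractive and of order zero can be tested after composition with
an injective `*`-homomorphism: such a homomorphism is isometric and reflects positivity. -/
lemma IsCPCOrderZero.of_comp_injective {φ : A →ₗ[ℂ] B} (π : B →⋆ₐ[ℂ] C)
    (hπ : Function.Injective π) (h : IsCPCOrderZero (π.toAlgHom.toLinearMap ∘ₗ φ)) :
    IsCPCOrderZero φ := by
  have h0 : ∀ b, (∀ _ : Unit, π b = 0) → b = 0 := fun b hb =>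
    (map_eq_zero_iff π hπ).1 (hb ())
  exact
  { completelyPositive := .of_forall_comp (fun _ : Unit => π) h0 fun _ => h.completelyPositive
    contractive := fun a => by
      rw [← NonUnitalStarAlgHom.norm_map π hπ]
      exact h.contractive a
    orderZero := fun a b hab =>
      orthogonal_of_forall_map (fun _ : Unit => π) h0 fun _ => h.orderZero a b hab }

end CompletelyPositive

/-! ### Norms in the sequence algebra -/

section Sequences

variable {A : Type u} [CStarAlgebra A] [Nontrivial A]

lemma continuous_starAlgHom {A : Type u} {B : Type v} [CStarAlgebra A] [CStarAlgebra B]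
    (π : A →⋆ₐ[ℂ] B) : Continuous π :=
  AddMonoidHomClass.continuous_of_bound π 1 fun a => by
    rw [one_mul]
    exact NonUnitalStarAlgHom.norm_apply_le π a

lemma norm_coord_le {A : Type u} [CStarAlgebra A] (x : BoundedSeq A) (n : ℕ) : ‖x n‖ ≤ ‖x‖ :=
  lp.norm_apply_le_norm (by simp) x n

lemma norm_kappa_le (x : BoundedSeq A) : ‖kappa A x‖ ≤ ‖x‖ := norm_mk_le (nullSeq A) x

lemma kappa_surjective : Function.Surjective (kappa A) := Ideal.Quotient.mk_surjective

lemma kappa_eq_zero_iff {x : BoundedSeq A} :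
    kappa A x = 0 ↔ Tendsto (fun n => ‖x n‖) atTop (𝓝 0) :=
  Ideal.Quotient.eq_zero_iff_mem

lemma seqAlgMap_kappa {B : Type v} [CStarAlgebra B] [Nontrivial B] (φ : A →⋆ₐ[ℂ] B)
    (x : BoundedSeq A) : seqAlgMap φ (kappa A x) = kappa B (seqMap φ x) := rfl

lemma eventually_norm_lt_of_norm_kappa_lt {x : BoundedSeq A} {c : ℝ} (h : ‖kappa A x‖ < c) :
    ∀ᶠ n in atTop, ‖x n‖ < c := by
  obtain ⟨y, hy, hyc⟩ := norm_mk_lt (nullSeq A) (kappa A x) (sub_pos.2 h)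
  rw [add_sub_cancel] at hyc
  have h0 : Tendsto (fun n => ‖(x - y) n‖) atTop (𝓝 0) :=
    kappa_eq_zero_iff.1 (by rw [map_sub, sub_eq_zero]; exact hy.symm)
  filter_upwards [h0.eventually_lt_const (sub_pos.2 hyc)] with n hn
  calc ‖x n‖ = ‖(x - y) n + y n‖ := by rw [lp.coeFn_sub, Pi.sub_apply, sub_add_cancel]
    _ ≤ ‖(x - y) n‖ + ‖y n‖ := norm_add_le _ _
    _ < c := by linarith [norm_coord_le y n]

lemma norm_kappa_le_of_eventually_le {x : BoundedSeq A} {c : ℝ} (hc : 0 ≤ c)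
    (h : ∀ᶠ n in atTop, ‖x n‖ ≤ c) : ‖kappa A x‖ ≤ c := by
  obtain ⟨N, hN⟩ := eventually_atTop.1 h
  let y : BoundedSeq A := ⟨fun n => if N ≤ n then x n else 0, memℓp_infty ⟨‖x‖, by
    rintro _ ⟨n, rfl⟩
    dsimp only
    split_ifs
    · exact norm_coord_le x n
    · simp⟩⟩
  have hy : kappa A x = kappa A y := by
    rw [← sub_eq_zero, ← map_sub, kappa_eq_zero_iff]
    refine tendsto_const_nhds.congr' ?_
    filter_upwards [eventually_ge_atTop N] with n hn
    change 0 = ‖x n - (if N ≤ n then x n else 0)‖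
    simp [hn]
  rw [hy]
  refine (norm_kappa_le y).trans (lp.norm_le_of_forall_le hc fun n => ?_)
  change ‖if N ≤ n then x n else 0‖ ≤ c
  split_ifs with hn
  · exact hN n hn
  · simpa using hc

instance instNontrivialBoundedSeq : Nontrivial (BoundedSeq A) :=
  ⟨0, constSeq 1, fun h => zero_ne_one (congrArg (fun x : BoundedSeq A => x 0) h)⟩

instance instNontrivialSeqAlg : Nontrivial (SeqAlg A) := by
  refine ⟨0, kappa A (constSeq 1), fun h => ?_⟩
  have := kappa_eq_zero_iff.1 h.symm
  have h1 : (fun n => ‖(constSeq (1 : A)) n‖) = fun _ => ‖(1 : A)‖ := rfl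
  rw [h1] at this
  exact one_ne_zero (norm_eq_zero.1 (tendsto_nhds_unique tendsto_const_nhds this))

lemma continuous_constSeq : Continuous (constSeq : A → BoundedSeq A) := by
  refine LipschitzWith.continuous (K := 1) (LipschitzWith.of_dist_le_mul fun a b => ?_)
  rw [dist_eq_norm, dist_eq_norm, NNReal.coe_one, one_mul]
  exact lp.norm_le_of_forall_le (norm_nonneg _) fun n => le_rfl

/-- The evaluation homomorphism `x ↦ x n` on bounded sequences. -/
def evalHom (A : Type u) [CStarAlgebra A] [Nontrivial A] (n : ℕ) : BoundedSeq A →⋆ₐ[ℂ] A where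
  toFun x := x n
  map_one' := rfl
  map_mul' _ _ := rfl
  map_zero' := rfl
  map_add' _ _ := rfl
  commutes' _ := rfl
  map_star' _ := rfl

end Sequences

/-! ### Sequences with continuous orbits -/

section ContSeq

variable {G : Type v} [Group G] [TopologicalSpace G]
  {A : Type u} [CStarAlgebra A] [Nontrivial A] (α : CStarAction G A)

lemma CStarAction.hom_mul_apply {A : Type u} [CStarAlgebra A] (α : CStarAction G A) (g h : G)
    (a : A) : α.hom (g * h) a = α.hom g (α.hom h a) := by
  simp only [CStarAction.hom_apply, map_mul]
  rfl

lemma CStarAction.hom_one_apply {A : Type u} [CStarAlgebra A] (α : CStarAction G A) (a : A) :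
    α.hom 1 a = a := by
  rw [CStarAction.hom_apply, map_one]
  rfl

lemma seqMap_hom_mul (g h : G) (x : BoundedSeq A) :
    seqMap (α.hom (g * h)) x = seqMap (α.hom g) (seqMap (α.hom h) x) := by
  ext n
  exact α.hom_mul_apply g h (x n)

variable {α}

lemma mem_contSeq_iff {x : BoundedSeq A} :
    x ∈ contSeq α ↔ Continuous fun g => seqMap (α.hom g) x := Iff.rfl

lemma isClosed_contSeq : IsClosed (contSeq α : Set (BoundedSeq A)) := by
  refine isClosed_of_closure_subset fun x hx => mem_contSeq_iff.2 ?_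
  rw [Metric.mem_closure_iff] at hx
  refine continuous_of_uniform_approx_of_continuous fun U hU => ?_
  obtain ⟨ε, hε, hεU⟩ := Metric.mem_uniformity_dist.1 hU
  obtain ⟨y, hy, hxy⟩ := hx ε hε
  refine ⟨fun g => seqMap (α.hom g) y, hy, fun g => hεU ?_⟩
  rw [dist_eq_norm, ← map_sub]
  rw [dist_eq_norm] at hxy
  exact (NonUnitalStarAlgHom.norm_apply_le _ _).trans_lt hxy

lemma continuous_orbit_of_mem_contSeqAlg {y : SeqAlg A} (hy : y ∈ contSeqAlg α) :
    Continuous fun g => seqAlgMap (α.hom g) y := by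
  obtain ⟨x, hx, rfl⟩ := hy
  exact (continuous_starAlgHom (kappa A)).comp (mem_contSeq_iff.1 hx)

variable [IsTopologicalGroup G]

/-- Each entry of a sequence has a continuous orbit, so only the tail has to be controlled, and
only near `1`. -/
lemma mem_contSeq_of_eventually {x : BoundedSeq A}
    (h : ∀ ε : ℝ, 0 < ε → ∃ K : ℕ, ∀ᶠ g in 𝓝 (1 : G), ∀ k ≥ K, ‖α.hom g (x k) - x k‖ ≤ ε) :
    x ∈ contSeq α := by
  have h1 : ∀ ε : ℝ, 0 < ε → ∀ᶠ g in 𝓝 (1 : G), ‖seqMap (α.hom g) x - x‖ ≤ ε := by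
    intro ε hε
    obtain ⟨K, hK⟩ := h ε hε
    have hfin : ∀ᶠ g in 𝓝 (1 : G), ∀ k ∈ Finset.range K, ‖α.hom g (x k) - x k‖ ≤ ε := by
      rw [eventually_all_finset]
      intro k _
      have hc : Continuous fun g => ‖α.hom g (x k) - x k‖ :=
        ((α.continuous_apply (x k)).sub continuous_const).norm
      have h0 : ‖α.hom 1 (x k) - x k‖ < ε := by
        rw [CStarAction.hom_one_apply, sub_self, norm_zero]
        exact hε
      exact (hc.continuousAt.eventually_lt_const h0).mono fun g hg => hg.le
    filter_upwards [hK, hfin] with g hg hg'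
    refine lp.norm_le_of_forall_le hε.le fun k => ?_
    by_cases hk : k < K
    · exact hg' k (Finset.mem_range.2 hk)
    · exact hg k (not_lt.1 hk)
  rw [mem_contSeq_iff, continuous_iff_continuousAt]
  intro g₀
  rw [Metric.continuousAt_iff']
  intro ε hε
  have ht : Tendsto (fun g => g₀⁻¹ * g) (𝓝 g₀) (𝓝 1) := by
    have : Continuous fun g => g₀⁻¹ * g := continuous_const_mul _
    simpa using this.tendsto g₀
  filter_upwards [ht.eventually (h1 (ε / 2) (half_pos hε))] with g hg
  have e : seqMap (α.hom g) x - seqMap (α.hom g₀) x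
      = seqMap (α.hom g₀) (seqMap (α.hom (g₀⁻¹ * g)) x - x) := by
    rw [map_sub, ← seqMap_hom_mul, mul_inv_cancel_left]
  rw [dist_eq_norm, e]
  exact ((NonUnitalStarAlgHom.norm_apply_le _ _).trans hg).trans_lt (half_lt_self hε)

lemma mem_contSeq_of_kappa_eq_zero {x : BoundedSeq A} (h : kappa A x = 0) : x ∈ contSeq α := by
  refine mem_contSeq_of_eventually fun ε hε => ?_
  obtain ⟨K, hK⟩ := eventually_atTop.1
    ((kappa_eq_zero_iff.1 h).eventually_lt_const (half_pos hε))
  refine ⟨K, Eventually.of_forall fun g k hk => ?_⟩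
  have h1 : ‖α.hom g (x k)‖ ≤ ‖x k‖ := NonUnitalStarAlgHom.norm_apply_le _ _
  linarith [norm_sub_le (α.hom g (x k)) (x k), hK k hk]

/-- Membership in `A_{∞,α}` does not depend on the lift, since `c_0(ℕ, A) ⊆ ℓ^∞_α(ℕ, A)`. -/
lemma kappa_mem_contSeqAlg_iff {x : BoundedSeq A} :
    kappa A x ∈ contSeqAlg α ↔ x ∈ contSeq α := by
  refine ⟨?_, fun h => ⟨x, h, rfl⟩⟩
  rintro ⟨y, hy, hxy⟩
  have hxy : kappa A y = kappa A x := hxy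
  have h0 : x - y ∈ contSeq α :=
    mem_contSeq_of_kappa_eq_zero (by rw [map_sub, hxy, sub_self])
  have := add_mem h0 hy
  rwa [sub_add_cancel] at this

lemma isClosed_contSeqAlg : IsClosed (contSeqAlg α : Set (SeqAlg A)) := by
  have hq : Topology.IsQuotientMap (kappa A) := by
    exact isQuotientMap_quotient_mk'
  rw [← hq.isClosed_preimage]
  convert isClosed_contSeq (α := α) using 1
  ext x
  exact kappa_mem_contSeqAlg_iff

end ContSeq

/-! ### Functoriality of Rokhlin systems -/

section Functoriality

variable {A : Type u} {B : Type w} [CStarAlgebra A] [Nontrivial A] [CStarAlgebra B] [Nontrivial B]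

lemma isClosed_setOf_commute {X : Type*} [TopologicalSpace X] {E : Type*} [CStarAlgebra E]
    {f : X → E} (hf : Continuous f) (y : E) : IsClosed {x | Commute (f x) y} :=
  isClosed_eq (hf.mul continuous_const) (continuous_const.mul hf)

lemma continuous_kappa_constSeq : Continuous fun a : A => kappa A (constSeq a) :=
  (continuous_starAlgHom (kappa A)).comp continuous_constSeq

lemma mem_relCommutant_iff {y : SeqAlg A} :
    y ∈ relCommutant A ↔ ∀ a : A, Commute (kappa A (constSeq a)) y := by
  rw [relCommutant, StarSubalgebra.mem_centralizer_iff]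
  refine ⟨fun h a => (h _ ⟨a, rfl⟩).1, ?_⟩
  rintro h _ ⟨a, rfl⟩
  exact ⟨h a, h (star a)⟩

/-- It suffices to commute with a dense subset of `A`. -/
lemma mem_relCommutant_of_dense {s : Set A} (hs : Dense s) {y : SeqAlg A}
    (h : ∀ a ∈ s, Commute (kappa A (constSeq a)) y) : y ∈ relCommutant A := by
  refine mem_relCommutant_iff.2 fun a => ?_
  have hcl := isClosed_setOf_commute continuous_kappa_constSeq y
  exact closure_minimal (fun a ha => h a ha) hcl (hs.closure_eq ▸ Set.mem_univ a)

lemma seqMap_constSeq (π : A →⋆ₐ[ℂ] B) (a : A) : seqMap π (constSeq a) = constSeq (π a) := rfl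

lemma commute_seqAlgMap_constSeq {y : SeqAlg A} (hy : y ∈ relCommutant A) (π : A →⋆ₐ[ℂ] B)
    (a : A) : Commute (kappa B (constSeq (π a))) (seqAlgMap π y) := by
  rw [← seqMap_constSeq, ← seqAlgMap_kappa]
  exact (mem_relCommutant_iff.1 hy a).map (seqAlgMap π)

/-- An element `b` that commutes with the range of `π` commutes with the range of `π_∞`. -/
lemma commute_seqAlgMap_constSeq_of_commute (π : A →⋆ₐ[ℂ] B) {b : B}
    (hb : ∀ a, Commute b (π a)) (y : SeqAlg A) :
    Commute (kappa B (constSeq b)) (seqAlgMap π y) := by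
  obtain ⟨x, rfl⟩ := kappa_surjective y
  rw [seqAlgMap_kappa]
  refine Commute.map (f := kappa B) ?_
  ext n
  exact hb (x n)

variable {G : Type v} [Group G] [TopologicalSpace G] {α : CStarAction G A} {β : CStarAction G B}

lemma seqMap_equivariant {π : A →⋆ₐ[ℂ] B}
    (hπ : ∀ g a, π (α.hom g a) = β.hom g (π a)) (g : G) (x : BoundedSeq A) :
    seqMap π (seqMap (α.hom g) x) = seqMap (β.hom g) (seqMap π x) := by
  ext n
  exact hπ g (x n)

lemma seqAlgMap_equivariant {π : A →⋆ₐ[ℂ] B}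
    (hπ : ∀ g a, π (α.hom g a) = β.hom g (π a)) (g : G) (y : SeqAlg A) :
    seqAlgMap π (seqAlgMap (α.hom g) y) = seqAlgMap (β.hom g) (seqAlgMap π y) := by
  obtain ⟨x, rfl⟩ := kappa_surjective y
  simp only [seqAlgMap_kappa, seqMap_equivariant hπ]

lemma seqAlgMap_mem_contSeqAlg {π : A →⋆ₐ[ℂ] B}
    (hπ : ∀ g a, π (α.hom g a) = β.hom g (π a)) {y : SeqAlg A} (hy : y ∈ contSeqAlg α) :
    seqAlgMap π y ∈ contSeqAlg β := by
  obtain ⟨x, hx, rfl⟩ := hy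
  refine ⟨seqMap π x, ?_, rfl⟩
  change Continuous fun g => seqMap (β.hom g) (seqMap π x)
  simp only [← seqMap_equivariant hπ]
  exact (continuous_starAlgHom (seqMap π)).comp (mem_contSeq_iff.1 hx)

variable [IsTopologicalGroup G] [CompactSpace G]

/-- An equivariant unital `*`-homomorphism `A → B` whose extension to the sequence algebras maps
`A_∞ ∩ A'` into `B_∞ ∩ B'` pushes Rokhlin systems for `A` forward to Rokhlin systems for `B`. -/
lemma IsRokhlinSystem.map {d : ℕ} {φ : Fin (d + 1) → C(G, ℂ) →ₗ[ℂ] SeqAlg A}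
    (h : IsRokhlinSystem α φ) {π : A →⋆ₐ[ℂ] B} (hπ : ∀ g a, π (α.hom g a) = β.hom g (π a))
    (hc : ∀ y ∈ relCommutant A, seqAlgMap π y ∈ relCommutant B) :
    IsRokhlinSystem β fun j => (seqAlgMap π).toAlgHom.toLinearMap ∘ₗ φ j where
  mem j f := ⟨seqAlgMap_mem_contSeqAlg hπ (h.mem j f).1, hc _ (h.mem j f).2⟩
  cpcOrderZero j := (h.cpcOrderZero j).comp_starAlgHom _
  equivariant j g f := by
    change seqAlgMap π (φ j (leftTranslate g f)) = seqAlgMap (β.hom g) (seqAlgMap π (φ j f))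
    rw [h.equivariant, seqAlgMap_equivariant hπ]
  sum_one := by
    change ∑ j, seqAlgMap π (φ j 1) = 1
    rw [← map_sum, h.sum_one]
    exact (seqAlgMap π).map_one'

lemma dimRok_le_of_map {π : A →⋆ₐ[ℂ] B} (hπ : ∀ g a, π (α.hom g a) = β.hom g (π a))
    (hc : ∀ y ∈ relCommutant A, seqAlgMap π y ∈ relCommutant B) : dimRok β ≤ dimRok α := by
  refine sInf_le_sInf ?_
  rintro _ ⟨d, rfl, φ, hφ⟩
  exact ⟨d, rfl, _, hφ.map hπ hc⟩

lemma dimRokComm_le_of_map {π : A →⋆ₐ[ℂ] B} (hπ : ∀ g a, π (α.hom g a) = β.hom g (π a))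
    (hc : ∀ y ∈ relCommutant A, seqAlgMap π y ∈ relCommutant B) :
    dimRokComm β ≤ dimRokComm α := by
  refine sInf_le_sInf ?_
  rintro _ ⟨d, rfl, φ, hφ, hcomm⟩
  exact ⟨d, rfl, _, hφ.map hπ hc, fun j k hjk f h => (hcomm j k hjk f h).map (seqAlgMap π)⟩

end Functoriality

/-! ### Tensor products and quotients -/

section TensorQuotient

variable {A : Type u} {B : Type v} {C : Type w} [CStarAlgebra A] [CStarAlgebra B] [CStarAlgebra C]
  {G : Type*} [Group G] [TopologicalSpace G]
  {α : CStarAction G A} {β : CStarAction G B} {γ : CStarAction G C} {j : A ⊗[ℂ] B →⋆ₐ[ℂ] C}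

lemma dense_span_range_tmul (hj : DenseRange j) :
    Dense (Submodule.span ℂ {c | ∃ a b, j (a ⊗ₜ[ℂ] b) = c} : Set C) := by
  refine hj.mono ?_
  rintro _ ⟨x, rfl⟩
  induction x using TensorProduct.induction_on with
  | zero => rw [map_zero]; exact Submodule.zero_mem _
  | tmul a b => exact Submodule.subset_span ⟨a, b, rfl⟩
  | add x y hx hy => rw [map_add]; exact Submodule.add_mem _ hx hy

/-- The first factor embedding `a ↦ a ⊗ 1`. -/
def leftFactor (j : A ⊗[ℂ] B →⋆ₐ[ℂ] C) : A →⋆ₐ[ℂ] C :=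
  { j.toAlgHom.comp Algebra.TensorProduct.includeLeft with
    map_star' := fun a => by
      change j (star a ⊗ₜ[ℂ] (1 : B)) = star (j (a ⊗ₜ[ℂ] 1))
      rw [← map_star, TensorProduct.star_tmul, star_one] }

/-- The second factor embedding `b ↦ 1 ⊗ b`. -/
def rightFactor (j : A ⊗[ℂ] B →⋆ₐ[ℂ] C) : B →⋆ₐ[ℂ] C :=
  { j.toAlgHom.comp Algebra.TensorProduct.includeRight with
    map_star' := fun b => by
      change j ((1 : A) ⊗ₜ[ℂ] star b) = star (j (1 ⊗ₜ[ℂ] b))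
      rw [← map_star, TensorProduct.star_tmul, star_one] }

lemma leftFactor_apply (a : A) : leftFactor j a = j (a ⊗ₜ[ℂ] 1) := rfl

lemma rightFactor_apply (b : B) : rightFactor j b = j (1 ⊗ₜ[ℂ] b) := rfl

lemma leftFactor_mul_rightFactor (a : A) (b : B) :
    leftFactor j a * rightFactor j b = j (a ⊗ₜ[ℂ] b) := by
  rw [leftFactor_apply, rightFactor_apply, ← map_mul, Algebra.TensorProduct.tmul_mul_tmul,
    mul_one, one_mul]

lemma commute_leftFactor_rightFactor (a : A) (b : B) :
    Commute (leftFactor j a) (rightFactor j b) := by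
  rw [commute_iff_eq, leftFactor_mul_rightFactor, leftFactor_apply, rightFactor_apply, ← map_mul,
    Algebra.TensorProduct.tmul_mul_tmul, mul_one, one_mul]

lemma IsTensorProductAction.leftFactor_equivariant (h : IsTensorProductAction α β γ j) (g : G)
    (a : A) : leftFactor j (α.hom g a) = γ.hom g (leftFactor j a) := by
  simp only [leftFactor_apply, CStarAction.hom_apply, h.apply_tmul, map_one]

lemma IsTensorProductAction.rightFactor_equivariant (h : IsTensorProductAction α β γ j) (g : G)
    (b : B) : rightFactor j (β.hom g b) = γ.hom g (rightFactor j b) := by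
  simp only [rightFactor_apply, CStarAction.hom_apply, h.apply_tmul, map_one]

/-- The quotient map `A → A/I`, as a `*`-homomorphism. -/
def quotientHom (I : Ideal A) [I.IsTwoSided] [IsClosed (I : Set A)] : A →⋆ₐ[ℂ] (A ⧸ I) :=
  { Ideal.Quotient.mkₐ ℂ I with map_star' := fun _ => rfl }

variable [Nontrivial A] [Nontrivial B] [Nontrivial C]

omit [Nontrivial A] [Nontrivial B] in
lemma mem_relCommutant_of_forall_tmul (hj : DenseRange j) {y : SeqAlg C}
    (h : ∀ a b, Commute (kappa C (constSeq (j (a ⊗ₜ[ℂ] b)))) y) : y ∈ relCommutant C := by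
  refine mem_relCommutant_of_dense (dense_span_range_tmul hj) fun c hc => ?_
  induction hc using Submodule.span_induction with
  | mem c hc =>
    obtain ⟨a, b, rfl⟩ := hc
    exact h a b
  | zero =>
    have : constSeq (0 : C) = 0 := rfl
    rw [this, map_zero]
    exact Commute.zero_left y
  | add c c' _ _ hc hc' =>
    have : constSeq (c + c') = constSeq c + constSeq c' := rfl
    rw [this, map_add]
    exact hc.add_left hc'
  | smul t c _ hc =>
    have : constSeq (t • c) = t • constSeq c := rfl
    rw [this, map_smul]
    exact hc.smul_left t

omit [Nontrivial A] [Nontrivial B] in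
lemma constSeq_tmul (a : A) (b : B) :
    kappa C (constSeq (j (a ⊗ₜ[ℂ] b)))
      = kappa C (constSeq (leftFactor j a)) * kappa C (constSeq (rightFactor j b)) := by
  rw [← leftFactor_mul_rightFactor, ← map_mul]
  rfl

omit [Nontrivial B] in
lemma leftFactor_mem_relCommutant (hj : DenseRange j) {y : SeqAlg A} (hy : y ∈ relCommutant A) :
    seqAlgMap (leftFactor j) y ∈ relCommutant C := by
  refine mem_relCommutant_of_forall_tmul hj fun a b => ?_
  rw [constSeq_tmul]
  exact (commute_seqAlgMap_constSeq hy _ a).mul_left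
    (commute_seqAlgMap_constSeq_of_commute _
      (fun a' => (commute_leftFactor_rightFactor a' b).symm) y)

omit [Nontrivial A] in
lemma rightFactor_mem_relCommutant (hj : DenseRange j) {y : SeqAlg B} (hy : y ∈ relCommutant B) :
    seqAlgMap (rightFactor j) y ∈ relCommutant C := by
  refine mem_relCommutant_of_forall_tmul hj fun a b => ?_
  rw [constSeq_tmul]
  exact (commute_seqAlgMap_constSeq_of_commute _
    (fun b' => commute_leftFactor_rightFactor a b') y).mul_left (commute_seqAlgMap_constSeq hy _ b)

lemma quotientHom_mem_relCommutant (I : Ideal A) [I.IsTwoSided] [IsClosed (I : Set A)]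
    [Nontrivial (A ⧸ I)] {y : SeqAlg A} (hy : y ∈ relCommutant A) :
    seqAlgMap (quotientHom I) y ∈ relCommutant (A ⧸ I) := by
  refine mem_relCommutant_iff.2 fun b => ?_
  obtain ⟨a, rfl⟩ := Ideal.Quotient.mk_surjective b
  exact commute_seqAlgMap_constSeq hy (quotientHom I) a

end TensorQuotient

/-! ### Transfer of order zero maps along norm-decreasing correspondences -/

section Transfer

lemma isSeparable_adjoin {E : Type*} [CStarAlgebra E] {s : Set E} (hs : s.Countable) :
    TopologicalSpace.IsSeparable (StarAlgebra.adjoin ℂ s : Set E) := by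
  have hcount : (s ∪ star s).Countable := by
    refine hs.union ?_
    rw [← Set.image_star]
    exact hs.image _
  have : Countable (s ∪ star s : Set E) := hcount.to_subtype
  have : Countable (FreeMonoid (s ∪ star s : Set E)) :=
    inferInstanceAs (Countable (List (s ∪ star s : Set E)))
  have hcl : (Submonoid.closure (s ∪ star s) : Set E).Countable := by
    rw [Submonoid.closure_eq_mrange, MonoidHom.coe_mrange]
    exact Set.countable_range _
  have h := (hcl.isSeparable).span (R := ℂ)
  rw [← StarAlgebra.adjoin_eq_span] at h
  exact h

variable {E : Type u} {Q : Type v} {F : Type w} [CStarAlgebra E] [CStarAlgebra Q] [CStarAlgebra F]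

/-- The image of a C*-algebra under a `*`-homomorphism is closed. -/
lemma isClosed_range_starAlgHom (p : E →⋆ₐ[ℂ] Q) : IsClosed (Set.range p) := by
  let J : Ideal E := RingHom.ker p
  have hJ : IsClosed (J : Set E) := isClosed_singleton.preimage (continuous_starAlgHom p)
  let p' : (E ⧸ J) →⋆ₐ[ℂ] Q :=
    { Ideal.Quotient.liftₐ J p.toAlgHom (fun a ha => ha) with
      map_star' := by
        rintro ⟨a⟩
        exact map_star p a }
  have hp' : ∀ a, p' (Ideal.Quotient.mk J a) = p a := fun _ => rfl
  have hinj : Function.Injective p' := by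
    refine (injective_iff_map_eq_zero p').2 fun y hy => ?_
    obtain ⟨a, rfl⟩ := Ideal.Quotient.mk_surjective y
    exact Ideal.Quotient.eq_zero_iff_mem.2 hy
  have hr : Set.range p = Set.range p' := by
    ext y
    constructor
    · rintro ⟨a, rfl⟩
      exact ⟨Ideal.Quotient.mk J a, hp' a⟩
    · rintro ⟨x, rfl⟩
      obtain ⟨a, rfl⟩ := Ideal.Quotient.mk_surjective x
      exact ⟨a, (hp' a).symm⟩
  rw [hr]
  exact (NonUnitalStarAlgHom.isometry p' hinj).isClosedEmbedding.isClosed_range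

lemma isClosed_map_starAlgHom (q : E →⋆ₐ[ℂ] Q) (S : StarSubalgebra ℂ E)
    [IsClosed (S : Set E)] : IsClosed (S.map q : Set Q) := by
  convert isClosed_range_starAlgHom (q.comp S.subtype) using 1
  ext y
  constructor
  · rintro ⟨x, hx, rfl⟩
    exact ⟨⟨x, hx⟩, rfl⟩
  · rintro ⟨x, rfl⟩
    exact ⟨x, x.2, rfl⟩

lemma exists_starAlgHom_map (q : E →⋆ₐ[ℂ] Q) (θ : E →⋆ₐ[ℂ] F) (S : StarSubalgebra ℂ E)
    (h : ∀ x ∈ S, ‖θ x‖ ≤ ‖q x‖) :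
    ∃ Θ : S.map q →⋆ₐ[ℂ] F, ∀ (y : S.map q), ∀ x ∈ S, q x = y → Θ y = θ x := by
  have hex : ∀ y : S.map q, ∃ x ∈ S, q x = y := fun y => y.2
  choose s hs hqs using hex
  have key : ∀ (y : S.map q), ∀ x ∈ S, q x = y → θ (s y) = θ x := by
    intro y x hx hxy
    rw [← sub_eq_zero, ← map_sub, ← norm_le_zero_iff]
    refine (h _ (sub_mem (hs y) hx)).trans ?_
    rw [map_sub, hqs, hxy, sub_self, norm_zero]
  refine ⟨
    { toFun := fun y => θ (s y)
      map_one' := by rw [key 1 1 (one_mem S) (map_one q), map_one]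
      map_zero' := by rw [key 0 0 (zero_mem S) (map_zero q), map_zero]
      map_mul' := fun y z => by
        rw [key (y * z) (s y * s z) (mul_mem (hs y) (hs z)) (by rw [map_mul, hqs, hqs]; rfl),
          map_mul]
      map_add' := fun y z => by
        rw [key (y + z) (s y + s z) (add_mem (hs y) (hs z)) (by rw [map_add, hqs, hqs]; rfl),
          map_add]
      commutes' := fun c => by
        rw [key _ (algebraMap ℂ E c) (algebraMap_mem S c) (AlgHomClass.commutes q c),
          AlgHomClass.commutes θ c]
      map_star' := fun y => by
        rw [key (star y) (star (s y)) (star_mem (hs y)) (by rw [map_star, hqs]; rfl), map_star] },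
    key⟩

/-- Let `q : E → Q` and `θ : E → F` be `*`-homomorphisms such that `‖θ x‖ ≤ ‖q x‖` on the
C*-subalgebra `S` of `E`. Then `q x ↦ θ x` is a `*`-homomorphism on `q(S)`, and order zero maps into
`Q` which on a dense set take values in `q(S)` can be composed with it. -/
lemma exists_transfer {X : Type*} [CStarAlgebra X] {ι : Type*} [Fintype ι] (q : E →⋆ₐ[ℂ] Q)
    (θ : E →⋆ₐ[ℂ] F) (S : StarSubalgebra ℂ E) (hS : IsClosed (S : Set E))
    (h : ∀ x ∈ S, ‖θ x‖ ≤ ‖q x‖) (Ψ : ι → X →ₗ[ℂ] Q) (hΨ : ∀ j, IsCPCOrderZero (Ψ j))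
    {D : Set X} (hD : Dense D) (hDS : ∀ j, ∀ f ∈ D, ∃ x ∈ S, q x = Ψ j f) :
    ∃ φ : ι → X →ₗ[ℂ] F, (∀ j, IsCPCOrderZero (φ j)) ∧
      (∀ j f, ∀ x ∈ S, q x = Ψ j f → φ j f = θ x) ∧
      (∑ j, Ψ j 1 = 1 → ∑ j, φ j 1 = 1) ∧
      (∀ j l f k, Commute (Ψ j f) (Ψ l k) → Commute (φ j f) (φ l k)) ∧
      (∀ j f, ∀ x ∈ S, Commute (q x) (Ψ j f) → Commute (θ x) (φ j f)) := by
  have hR : IsClosed (S.map q : Set Q) := isClosed_map_starAlgHom q S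
  obtain ⟨Θ, hΘ⟩ := exists_starAlgHom_map q θ S h
  have hcont : ∀ j, Continuous (Ψ j) := fun j =>
    AddMonoidHomClass.continuous_of_bound (Ψ j) 1 fun a => by
      rw [one_mul]
      exact (hΨ j).contractive a
  have hmem : ∀ j f, Ψ j f ∈ S.map q := by
    intro j f
    exact closure_minimal (s := D) (t := Ψ j ⁻¹' (S.map q : Set Q)) (fun f hf => hDS j f hf)
      (hR.preimage (hcont j)) (hD f)
  let Ψ' : ι → X →ₗ[ℂ] S.map q := fun j =>
    { toFun := fun f => ⟨Ψ j f, hmem j f⟩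
      map_add' := fun f k => Subtype.ext (map_add (Ψ j) f k)
      map_smul' := fun c f => Subtype.ext (map_smul (Ψ j) c f) }
  have hΨ' : ∀ j, IsCPCOrderZero (Ψ' j) := fun j =>
    IsCPCOrderZero.of_comp_injective (S.map q).subtype Subtype.val_injective (hΨ j)
  refine ⟨fun j => Θ.toAlgHom.toLinearMap ∘ₗ Ψ' j, fun j => (hΨ' j).comp_starAlgHom Θ,
    fun j f x hx hxf => hΘ (Ψ' j f) x hx hxf, fun h1 => ?_, fun j l f k hc => ?_,
    fun j f x hx hc => ?_⟩
  · have : ∑ j, Ψ' j 1 = 1 := Subtype.ext (by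
      rw [AddSubmonoidClass.coe_finsetSum]
      exact h1)
    change ∑ j, Θ (Ψ' j 1) = 1
    rw [← map_sum, this, map_one]
  · have : Commute (Ψ' j f) (Ψ' l k) := Subtype.ext hc
    exact this.map Θ
  · have : Commute (⟨q x, x, hx, rfl⟩ : S.map q) (Ψ' j f) := Subtype.ext hc
    have := this.map Θ
    rwa [hΘ ⟨q x, x, hx, rfl⟩ x hx rfl] at this

lemma eq_of_denseRange {ι X E : Type*} [TopologicalSpace X] [CStarAlgebra E] {s : ι → X}
    (hs : DenseRange s) {f g : X → E} (hf : Continuous f) (hg : Continuous g)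
    (h : ∀ i, f (s i) = g (s i)) (x : X) : f x = g x :=
  congrFun (hs.equalizer hf hg (funext h)) x

end Transfer

/-! ### Diagonal sequences -/

section Diagonal

variable {A : Type u} [CStarAlgebra A] [Nontrivial A]

/-- The `*`-homomorphism `(x_{k,n})_{k,n} ↦ (x_{k,m(k)})_k`. -/
def diagHom (m : ℕ → ℕ) : BoundedSeq (BoundedSeq A) →⋆ₐ[ℂ] BoundedSeq A where
  toFun x := ⟨fun k => x k (m k), memℓp_infty ⟨‖x‖, by
    rintro _ ⟨k, rfl⟩
    exact (norm_coord_le (x k) (m k)).trans (norm_coord_le x k)⟩⟩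
  map_one' := rfl
  map_mul' _ _ := rfl
  map_zero' := rfl
  map_add' _ _ := rfl
  commutes' _ := rfl
  map_star' _ := rfl

lemma diagHom_apply (m : ℕ → ℕ) (x : BoundedSeq (BoundedSeq A)) (k : ℕ) :
    diagHom m x k = x k (m k) := rfl

variable (A) in
/-- The quotient map `ℓ^∞(ℕ, ℓ^∞(ℕ, A)) → (A_∞)_∞`. -/
def kappaTwo : BoundedSeq (BoundedSeq A) →⋆ₐ[ℂ] SeqAlg (SeqAlg A) :=
  (kappa (SeqAlg A)).comp (seqMap (kappa A))

lemma kappaTwo_apply (x : BoundedSeq (BoundedSeq A)) :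
    kappaTwo A x = kappa (SeqAlg A) (seqMap (kappa A) x) := rfl

lemma seqMap_kappa_surjective : Function.Surjective (seqMap (kappa A)) := by
  intro y
  have h : ∀ k, ∃ x : BoundedSeq A, kappa A x = y k ∧ ‖x‖ < ‖y k‖ + 1 := fun k =>
    norm_mk_lt (nullSeq A) (y k) one_pos
  choose x hx hn using h
  refine ⟨⟨x, memℓp_infty ⟨‖y‖ + 1, ?_⟩⟩, ?_⟩
  · rintro _ ⟨k, rfl⟩
    exact (hn k).le.trans (by gcongr; exact norm_coord_le y k)
  · ext k
    exact hx k

/-- The choice of a diagonal: `m k` has to satisfy only finitely many of the countably many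
eventual conditions on it. -/
lemma exists_forall_le_of_forall_eventually {P : ℕ → ℕ → ℕ → Prop}
    (hP : ∀ i k, ∀ᶠ m in atTop, P i k m) : ∃ m : ℕ → ℕ, ∀ i, ∀ k ≥ i, P i k (m k) := by
  have h : ∀ k, ∃ m, ∀ i ∈ Finset.range (k + 1), P i k m := fun k =>
    ((eventually_all_finset (Finset.range (k + 1))).2 fun i _ => hP i k).exists
  choose m hm using h
  exact ⟨m, fun i k hk => hm k i (Finset.mem_range.2 (Nat.lt_succ_of_le hk))⟩

lemma norm_kappa_diagHom_le {m : ℕ → ℕ} {x : BoundedSeq (BoundedSeq A)} {i : ℕ}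
    (h : ∀ k ≥ i, ‖x k (m k)‖ ≤ ‖kappa A (x k)‖ + 1 / ((k : ℝ) + 1)) :
    ‖kappa A (diagHom m x)‖ ≤ ‖kappaTwo A x‖ := by
  refine le_of_forall_pos_le_add fun ε hε => ?_
  refine norm_kappa_le_of_eventually_le (by positivity) ?_
  have h1 : ∀ᶠ k in atTop, ‖seqMap (kappa A) x k‖ < ‖kappaTwo A x‖ + ε / 2 :=
    eventually_norm_lt_of_norm_kappa_lt (by rw [← kappaTwo_apply]; linarith)
  have h2 : ∀ᶠ k : ℕ in atTop, 1 / ((k : ℝ) + 1) < ε / 2 :=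
    tendsto_one_div_add_atTop_nhds_zero_nat.eventually_lt_const (half_pos hε)
  filter_upwards [h1, h2, eventually_ge_atTop i] with k hk1 hk2 hk
  rw [seqMap_apply] at hk1
  rw [diagHom_apply]
  linarith [h k hk]

/-- A countable saturation property: on a separable set, `(A_∞)_∞` reduces to `A_∞` along a
suitable diagonal, which in addition can be chosen subject to countably many conditions. -/
lemma exists_diagonal {S : Set (BoundedSeq (BoundedSeq A))} (hS : TopologicalSpace.IsSeparable S)
    {P : ℕ → ℕ → ℕ → Prop} (hP : ∀ i k, ∀ᶠ m in atTop, P i k m) :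
    ∃ m : ℕ → ℕ, (∀ x ∈ S, ‖kappa A (diagHom m x)‖ ≤ ‖kappaTwo A x‖) ∧
      ∀ i, ∀ k ≥ i, P i k (m k) := by
  obtain ⟨c, hc, hSc⟩ := hS
  obtain ⟨s, hs⟩ := (hc.insert 0).exists_eq_range (Set.insert_nonempty 0 c)
  have hev : ∀ i k, ∀ᶠ m in atTop,
      ‖s i k m‖ ≤ ‖kappa A (s i k)‖ + 1 / ((k : ℝ) + 1) ∧ P i k m := fun i k =>
    ((eventually_norm_lt_of_norm_kappa_lt
      (lt_add_of_pos_right ‖kappa A (s i k)‖ Nat.one_div_pos_of_nat)).mono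
        fun m hm => hm.le).and (hP i k)
  obtain ⟨m, hm⟩ := exists_forall_le_of_forall_eventually hev
  refine ⟨m, fun x hx => ?_, fun i k hk => (hm i k hk).2⟩
  have hcl : IsClosed {x | ‖kappa A (diagHom m x)‖ ≤ ‖kappaTwo A x‖} :=
    isClosed_le (continuous_starAlgHom ((kappa A).comp (diagHom m))).norm
      (continuous_starAlgHom (kappaTwo A)).norm
  refine closure_minimal ?_ hcl (closure_mono (Set.subset_insert 0 c) (hSc hx))
  rw [hs]
  rintro _ ⟨i, rfl⟩
  exact norm_kappa_diagHom_le fun k hk => (hm i k hk).1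

/-- For a continuous family of sequences over a compact space, the limit superior defining the
norm of `A_∞` is attained uniformly. -/
lemma eventually_forall_norm_le {K : Type*} [TopologicalSpace K] [CompactSpace K]
    {y : K → BoundedSeq A} (hy : Continuous y) {b : K → ℝ} (hb : Continuous b)
    (h : ∀ t, ‖kappa A (y t)‖ ≤ b t) {ε : ℝ} (hε : 0 < ε) :
    ∀ᶠ n in atTop, ∀ t, ‖y t n‖ ≤ b t + ε := by
  have key : ∀ᶠ n in atTop, ∀ t ∈ (Set.univ : Set K), ‖y t n‖ ≤ b t + ε := by
    refine isCompact_univ.induction_on (p := fun s => ∀ᶠ n in atTop, ∀ t ∈ s, ‖y t n‖ ≤ b t + ε)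
      ?_ ?_ ?_ ?_
    · simp
    · intro s t hst ht
      exact ht.mono fun n hn x hx => hn x (hst hx)
    · intro s t hs ht
      filter_upwards [hs, ht] with n h1 h2 x hx
      exact hx.elim (h1 x) (h2 x)
    · intro t₀ _
      have h1 : ∀ᶠ n in atTop, ‖y t₀ n‖ < b t₀ + ε / 3 :=
        eventually_norm_lt_of_norm_kappa_lt ((h t₀).trans_lt (by linarith))
      have h2 : ∀ᶠ t in 𝓝 t₀, ‖y t - y t₀‖ < ε / 3 := by
        have hc : Continuous fun t => ‖y t - y t₀‖ := (hy.sub continuous_const).norm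
        refine hc.continuousAt.eventually_lt_const ?_
        change ‖y t₀ - y t₀‖ < ε / 3
        rw [sub_self, norm_zero]
        linarith
      have h3 : ∀ᶠ t in 𝓝 t₀, b t₀ - ε / 3 < b t :=
        hb.continuousAt.eventually_const_lt (by linarith)
      refine ⟨{t | ‖y t - y t₀‖ < ε / 3 ∧ b t₀ - ε / 3 < b t},
        mem_nhdsWithin_of_mem_nhds (h2.and h3), ?_⟩
      filter_upwards [h1] with n hn t ht
      have h4 : ‖y t n - y t₀ n‖ ≤ ‖y t - y t₀‖ := norm_coord_le (y t - y t₀) n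
      have h5 : ‖y t n‖ ≤ ‖y t n - y t₀ n‖ + ‖y t₀ n‖ := norm_le_norm_sub_add _ _
      linarith [ht.1, ht.2]
  exact key.mono fun n hn t => hn t (Set.mem_univ t)

variable {X : Type v} [CStarAlgebra X]

/-- The map `f ↦ (ψ_k f)_k` defined by a sequence of linear contractions. -/
def seqOfContractions (ψ : ℕ → X →ₗ[ℂ] A) (h : ∀ k f, ‖ψ k f‖ ≤ ‖f‖) : X →ₗ[ℂ] BoundedSeq A where
  toFun f := ⟨fun k => ψ k f, memℓp_infty ⟨‖f‖, by rintro _ ⟨k, rfl⟩; exact h k f⟩⟩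
  map_add' f g := by ext k; exact map_add (ψ k) f g
  map_smul' c f := by ext k; exact map_smul (ψ k) c f

lemma isCPCOrderZero_seqOfContractions {ψ : ℕ → X →ₗ[ℂ] A} (h : ∀ k, IsCPCOrderZero (ψ k)) :
    IsCPCOrderZero (seqOfContractions ψ fun k => (h k).contractive) := by
  have h0 : ∀ x : BoundedSeq A, (∀ n, evalHom A n x = 0) → x = 0 := fun x hx => lp.ext (funext hx)
  exact
  { completelyPositive := .of_forall_comp (evalHom A) h0 fun n => (h n).completelyPositive
    contractive := fun f => lp.norm_le_of_forall_le (norm_nonneg _) fun n => (h n).contractive f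
    orderZero := fun a b hab => orthogonal_of_forall_map (evalHom A) h0 fun n =>
      (h n).orderZero a b hab }

lemma commute_kappa_of_eventually {x y : BoundedSeq A} (h : ∀ᶠ k in atTop, Commute (x k) (y k)) :
    Commute (kappa A x) (kappa A y) := by
  rw [commute_iff_eq, ← sub_eq_zero, ← map_mul, ← map_mul, ← map_sub, kappa_eq_zero_iff]
  refine tendsto_const_nhds.congr' (h.mono fun k hk => ?_)
  change 0 = ‖x k * y k - y k * x k‖
  rw [hk.eq, sub_self, norm_zero]

/-- The map `f ↦ [(ψ_k f)_k]` into the sequence algebra defined by a sequence of linear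
contractions. -/
def limitMap (ψ : ℕ → X →ₗ[ℂ] A) (h : ∀ k f, ‖ψ k f‖ ≤ ‖f‖) : X →ₗ[ℂ] SeqAlg A :=
  (kappa A).toAlgHom.toLinearMap ∘ₗ seqOfContractions ψ h

lemma limitMap_apply {ψ : ℕ → X →ₗ[ℂ] A} (h : ∀ k f, ‖ψ k f‖ ≤ ‖f‖) (f : X) :
    limitMap ψ h f = kappa A (seqOfContractions ψ h f) := rfl

lemma isCPCOrderZero_limitMap {ψ : ℕ → X →ₗ[ℂ] A} (h : ∀ k, IsCPCOrderZero (ψ k)) :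
    IsCPCOrderZero (limitMap ψ fun k => (h k).contractive) :=
  (isCPCOrderZero_seqOfContractions h).comp_starAlgHom (kappa A)

lemma sum_limitMap_one {ι : Type*} [Fintype ι] {ψ : ι → ℕ → X →ₗ[ℂ] A}
    (h : ∀ j k f, ‖ψ j k f‖ ≤ ‖f‖) (h1 : ∀ k, ∑ j, ψ j k 1 = 1) :
    ∑ j, limitMap (ψ j) (h j) 1 = 1 := by
  have h2 : ∑ j, seqOfContractions (ψ j) (h j) 1 = 1 := by
    ext k
    rw [lp.coeFn_sum, Finset.sum_apply]
    exact h1 k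
  simp only [limitMap_apply]
  rw [← map_sum, h2]
  exact (kappa A).map_one'

/-- The constant double sequences commute with the limit map as soon as, asymptotically, a dense
set of them commutes with the individual maps. -/
lemma commute_kappaTwo_constSeq_limitMap {ψ : ℕ → X →ₗ[ℂ] SeqAlg A} (h : ∀ k f, ‖ψ k f‖ ≤ ‖f‖)
    {s : Set A} (hs : Dense s) {f : X}
    (hcomm : ∀ a ∈ s, ∀ᶠ k in atTop, Commute (kappa A (constSeq a)) (ψ k f)) (a : A) :
    Commute (kappaTwo A (constSeq (constSeq a))) (limitMap ψ h f) := by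
  have hcont : Continuous fun a : A => kappaTwo A (constSeq (constSeq a)) :=
    (continuous_starAlgHom (kappaTwo A)).comp (continuous_constSeq.comp continuous_constSeq)
  refine closure_minimal (s := s) (fun a ha => ?_)
    (isClosed_setOf_commute hcont (limitMap ψ h f)) (hs a)
  exact commute_kappa_of_eventually (x := seqMap (kappa A) (constSeq (constSeq a)))
    (y := seqOfContractions ψ h f) (hcomm a ha)

lemma exists_lift_limitMap {ψ : ℕ → X →ₗ[ℂ] SeqAlg A} (h : ∀ k f, ‖ψ k f‖ ≤ ‖f‖) (f : X) :
    ∃ x : BoundedSeq (BoundedSeq A), ∀ k, kappa A (x k) = ψ k f := by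
  obtain ⟨x, hx⟩ := seqMap_kappa_surjective (seqOfContractions ψ h f)
  exact ⟨x, fun k => congrArg (fun y : BoundedSeq (SeqAlg A) => y k) hx⟩

lemma kappaTwo_eq_limitMap {ψ : ℕ → X →ₗ[ℂ] SeqAlg A} (h : ∀ k f, ‖ψ k f‖ ≤ ‖f‖) {f : X}
    {x : BoundedSeq (BoundedSeq A)} (hx : ∀ k, kappa A (x k) = ψ k f) :
    kappaTwo A x = limitMap ψ h f := by
  rw [kappaTwo_apply, limitMap_apply]
  congr 1
  ext k
  exact hx k

end Diagonal

/-! ### Reindexing sequences of Rokhlin systems -/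

section Reindexing

variable {G : Type v} [Group G] [TopologicalSpace G] [IsTopologicalGroup G]

lemma leftTranslate_one (f : C(G, ℂ)) : leftTranslate 1 f = f := by
  ext x
  change f (1⁻¹ * x) = f x
  rw [inv_one, one_mul]

lemma continuous_leftTranslate (f : C(G, ℂ)) : Continuous fun g => leftTranslate g f := by
  refine ContinuousMap.continuous_of_continuous_uncurry _ ?_
  change Continuous fun p : G × G => f (p.1⁻¹ * p.2)
  fun_prop

lemma continuous_leftTranslate_right (g : G) :
    Continuous fun f : C(G, ℂ) => leftTranslate g f :=
  ContinuousMap.continuous_precomp _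

variable {A : Type u} [CStarAlgebra A] [Nontrivial A] {α : CStarAction G A}

/-- Equivariance can be tested on dense subsets of `G` and of `C(G)`. -/
lemma equivariant_of_denseRange {φ : C(G, ℂ) →ₗ[ℂ] SeqAlg A} (hφ : Continuous φ)
    (hmem : ∀ f, φ f ∈ contSeqAlg α) {σ : ℕ → G} (hσ : DenseRange σ) {D : ℕ → C(G, ℂ)}
    (hD : DenseRange D)
    (h : ∀ r i, φ (leftTranslate (σ r) (D i)) = seqAlgMap (α.hom (σ r)) (φ (D i)))
    (g : G) (f : C(G, ℂ)) : φ (leftTranslate g f) = seqAlgMap (α.hom g) (φ f) :=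
  eq_of_denseRange hσ (f := fun g => φ (leftTranslate g f))
    (g := fun g => seqAlgMap (α.hom g) (φ f)) (hφ.comp (continuous_leftTranslate f))
    (continuous_orbit_of_mem_contSeqAlg (hmem f))
    (fun r => eq_of_denseRange hD (f := fun f => φ (leftTranslate (σ r) f))
      (g := fun f => seqAlgMap (α.hom (σ r)) (φ f))
      (hφ.comp (continuous_leftTranslate_right (σ r)))
      ((continuous_starAlgHom (seqAlgMap (α.hom (σ r)))).comp hφ) (h r) f) g

variable [CompactSpace G]

/-- A lift of an element `ψ f`, for an equivariant linear contraction `ψ` into `A_{∞,α}`, has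
tails along which the modulus of continuity of the orbit is almost that of `f`, uniformly over
`G`. -/
lemma eventually_forall_norm_hom_sub_le {ψ : C(G, ℂ) →ₗ[ℂ] SeqAlg A}
    (hmem : ∀ f, ψ f ∈ contSeqAlg α) (hcontr : ∀ f, ‖ψ f‖ ≤ ‖f‖)
    (hequiv : ∀ g f, ψ (leftTranslate g f) = seqAlgMap (α.hom g) (ψ f))
    {f : C(G, ℂ)} {x : BoundedSeq A} (hx : kappa A x = ψ f) {ε : ℝ} (hε : 0 < ε) :
    ∀ᶠ n in atTop, ∀ g, ‖α.hom g (x n) - x n‖ ≤ ‖leftTranslate g f - f‖ + ε := by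
  have hxc : x ∈ contSeq α := kappa_mem_contSeqAlg_iff.1 (hx ▸ hmem f)
  have hy : Continuous fun g => seqMap (α.hom g) x - x :=
    (mem_contSeq_iff.1 hxc).sub continuous_const
  have hb : Continuous fun g => ‖leftTranslate g f - f‖ :=
    ((continuous_leftTranslate f).sub continuous_const).norm
  refine eventually_forall_norm_le hy hb (fun g => ?_) hε
  rw [map_sub, ← seqAlgMap_kappa, hx, ← hequiv, ← map_sub]
  exact hcontr _

/-- If the orbits of the entries are controlled by the orbit of a function `f`, up to a vanishing
error, then the sequence lies in `ℓ^∞_α(ℕ, A)`. -/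
lemma mem_contSeq_of_norm_hom_sub_le {f : C(G, ℂ)} {x : BoundedSeq A} {i : ℕ}
    (h : ∀ k ≥ i, ∀ g, ‖α.hom g (x k) - x k‖ ≤ ‖leftTranslate g f - f‖ + 1 / ((k : ℝ) + 1)) :
    x ∈ contSeq α := by
  refine mem_contSeq_of_eventually fun ε hε => ?_
  obtain ⟨K, hK⟩ := eventually_atTop.1
    ((tendsto_one_div_add_atTop_nhds_zero_nat (𝕜 := ℝ)).eventually_lt_const (half_pos hε))
  have hb : Continuous fun g => ‖leftTranslate g f - f‖ :=
    ((continuous_leftTranslate f).sub continuous_const).norm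
  have h0 : ‖leftTranslate 1 f - f‖ < ε / 2 := by
    rw [leftTranslate_one, sub_self, norm_zero]
    exact half_pos hε
  refine ⟨max i K, (hb.continuousAt.eventually_lt_const h0).mono fun g hg k hk => ?_⟩
  have h1 := h k ((le_max_left _ _).trans hk) g
  have h2 := hK k ((le_max_right _ _).trans hk)
  linarith

variable [SecondCountableTopology G] [TopologicalSpace.SeparableSpace A]

/-- A sequence of systems `ψ_k` of equivariant order zero maps into `A_{∞,α}`, which in the limit
`k → ∞` commute with `A`, can be reindexed to a Rokhlin system. -/
theorem exists_isRokhlinSystem_of_seq {d : ℕ} (ψ : Fin (d + 1) → ℕ → C(G, ℂ) →ₗ[ℂ] SeqAlg A)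
    (hmem : ∀ j k f, ψ j k f ∈ contSeqAlg α) (hcpc : ∀ j k, IsCPCOrderZero (ψ j k))
    (hequiv : ∀ j k g f, ψ j k (leftTranslate g f) = seqAlgMap (α.hom g) (ψ j k f))
    (hsum : ∀ k, ∑ j, ψ j k 1 = 1) {s : Set A} (hs : Dense s)
    (hcomm : ∀ j f, ∀ a ∈ s, ∀ᶠ k in atTop, Commute (kappa A (constSeq a)) (ψ j k f)) :
    ∃ φ : Fin (d + 1) → C(G, ℂ) →ₗ[ℂ] SeqAlg A, IsRokhlinSystem α φ ∧
      ∀ j l, (∀ k f h, Commute (ψ j k f) (ψ l k h)) → ∀ f h, Commute (φ j f) (φ l h) := by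
  have hcontr : ∀ j k f, ‖ψ j k f‖ ≤ ‖f‖ := fun j k => (hcpc j k).contractive
  -- The limit system takes values in `(A_∞)_∞`; `x j f` is a lift of `Ψ j f`.
  let Ψ : Fin (d + 1) → C(G, ℂ) →ₗ[ℂ] SeqAlg (SeqAlg A) := fun j => limitMap (ψ j) (hcontr j)
  choose x hx using fun j f => exists_lift_limitMap (hcontr j) f
  let D := TopologicalSpace.denseSeq C(G, ℂ)
  have hD : DenseRange D := TopologicalSpace.denseRange_denseSeq _
  let σ := TopologicalSpace.denseSeq G
  have hσ : DenseRange σ := TopologicalSpace.denseRange_denseSeq _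
  let c := TopologicalSpace.denseSeq A
  have hc : DenseRange c := TopologicalSpace.denseRange_denseSeq _
  let act : G → BoundedSeq (BoundedSeq A) →⋆ₐ[ℂ] BoundedSeq (BoundedSeq A) := fun g =>
    seqMap (seqMap (α.hom g))
  -- A separable C*-algebra `S` of double sequences is enough: it has to contain lifts of the
  -- `Ψ j f` and of their translates, for `f` in a dense sequence, and a dense part of `A`.
  obtain ⟨S, hSc, hSs, hS₁, hS₂, hS₃⟩ : ∃ S : StarSubalgebra ℂ (BoundedSeq (BoundedSeq A)),
      IsClosed (S : Set (BoundedSeq (BoundedSeq A))) ∧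
      TopologicalSpace.IsSeparable (S : Set (BoundedSeq (BoundedSeq A))) ∧
      (∀ j i, x j (D i) ∈ S) ∧ (∀ r j i, act (σ r) (x j (D i)) ∈ S) ∧
      ∀ i, constSeq (constSeq (c i)) ∈ S := by
    let T : Set (BoundedSeq (BoundedSeq A)) :=
      (Set.range fun p : Fin (d + 1) × ℕ => x p.1 (D p.2)) ∪
      (Set.range fun p : ℕ × Fin (d + 1) × ℕ => act (σ p.1) (x p.2.1 (D p.2.2))) ∪
      Set.range fun i : ℕ => constSeq (constSeq (c i))
    have hT : T.Countable := ((Set.countable_range _).union (Set.countable_range _)).union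
      (Set.countable_range _)
    have hTS : ∀ y ∈ T, y ∈ (StarAlgebra.adjoin ℂ T).topologicalClosure := fun y hy =>
      (StarAlgebra.adjoin ℂ T).le_topologicalClosure (StarAlgebra.subset_adjoin ℂ T hy)
    exact ⟨(StarAlgebra.adjoin ℂ T).topologicalClosure,
      (StarAlgebra.adjoin ℂ T).isClosed_topologicalClosure, (isSeparable_adjoin hT).closure,
      fun j i => hTS _ (Or.inl (Or.inl ⟨(j, i), rfl⟩)),
      fun r j i => hTS _ (Or.inl (Or.inr ⟨(r, j, i), rfl⟩)), fun i => hTS _ (Or.inr ⟨i, rfl⟩)⟩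
  -- The diagonal is chosen such that the images of the lifts have equicontinuous orbits.
  have hP : ∀ i k, ∀ᶠ n in atTop, ∀ j g, ‖α.hom g (x j (D i) k n) - x j (D i) k n‖
      ≤ ‖leftTranslate g (D i) - D i‖ + 1 / ((k : ℝ) + 1) := fun i k =>
    eventually_all.2 fun j => eventually_forall_norm_hom_sub_le (hmem j k) (hcontr j k)
      (hequiv j k) (hx j (D i) k) Nat.one_div_pos_of_nat
  obtain ⟨m, hm, hmP⟩ := exists_diagonal hSs hP
  obtain ⟨φ, hφ, hφθ, hφ1, hφc, hφr⟩ := exists_transfer (kappaTwo A) ((kappa A).comp (diagHom m))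
    S hSc hm Ψ (fun j => isCPCOrderZero_limitMap (hcpc j)) hD (by
      rintro j _ ⟨i, rfl⟩
      exact ⟨_, hS₁ j i, kappaTwo_eq_limitMap (hcontr j) (hx j (D i))⟩)
  have hφcont : ∀ j, Continuous (φ j) := fun j =>
    AddMonoidHomClass.continuous_of_bound (φ j) 1 fun f => by
      rw [one_mul]
      exact (hφ j).contractive f
  have hφD : ∀ j i, φ j (D i) = kappa A (diagHom m (x j (D i))) := fun j i =>
    hφθ j (D i) _ (hS₁ j i) (kappaTwo_eq_limitMap (hcontr j) (hx j (D i)))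
  have hφmem : ∀ j f, φ j f ∈ contSeqAlg α := by
    intro j f
    refine closure_minimal (s := Set.range D) (t := φ j ⁻¹' (contSeqAlg α : Set (SeqAlg A))) ?_
      (isClosed_contSeqAlg.preimage (hφcont j)) (hD f)
    rintro _ ⟨i, rfl⟩
    change φ j (D i) ∈ contSeqAlg α
    rw [hφD, kappa_mem_contSeqAlg_iff]
    exact mem_contSeq_of_norm_hom_sub_le (f := D i) fun k hk g => hmP i k hk j g
  refine ⟨φ, ⟨fun j f => ⟨hφmem j f, ?_⟩, hφ, fun j =>
    equivariant_of_denseRange (hφcont j) (hφmem j) hσ hD fun r i => ?_,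
    hφ1 (sum_limitMap_one hcontr hsum)⟩, fun j l h f f' => hφc j l f f' ?_⟩
  · refine mem_relCommutant_of_dense hc ?_
    rintro _ ⟨i, rfl⟩
    exact hφr j f _ (hS₃ i) (commute_kappaTwo_constSeq_limitMap (hcontr j) hs (hcomm j f) (c i))
  · have hlift : ∀ k, kappa A (act (σ r) (x j (D i)) k) = ψ j k (leftTranslate (σ r) (D i)) := by
      intro k
      change kappa A (seqMap (α.hom (σ r)) (x j (D i) k)) = _
      rw [← seqAlgMap_kappa, hx, hequiv]
    rw [hφθ j _ _ (hS₂ r j i) (kappaTwo_eq_limitMap (hcontr j) hlift), hφD]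
    rfl
  · exact commute_kappa_of_eventually (Eventually.of_forall fun k => h k f f')

end Reindexing

/-! ### Direct limits -/

section DirectLimit

lemma sInf_cast_le_iff {P : ℕ → Prop} {N : ℕ} :
    sInf {n : ℕ∞ | ∃ d : ℕ, n = d ∧ P d} ≤ N ↔ ∃ d ≤ N, P d := by
  constructor
  · intro h
    have hne : {n : ℕ∞ | ∃ d : ℕ, n = d ∧ P d}.Nonempty := by
      by_contra hne
      rw [Set.not_nonempty_iff_eq_empty.1 hne, sInf_empty, top_le_iff] at h
      exact ENat.natCast_ne_top N h
    obtain ⟨d, hd, hP⟩ := csInf_mem hne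
    rw [hd] at h
    exact ⟨d, by exact_mod_cast h, hP⟩
  · rintro ⟨d, hd, hP⟩
    have hd' : (d : ℕ∞) ≤ N := by exact_mod_cast hd
    exact le_trans (sInf_le ⟨d, rfl, hP⟩) hd'

/-- If `P d` holds whenever `Q n d` holds for infinitely many `n`, then the least `d` with `P d` is
at most the limit inferior of the least `d` with `Q n d`: when the latter is finite, one value `d`
is attained infinitely often. -/
lemma sInf_cast_le_liminf {P : ℕ → Prop} {Q : ℕ → ℕ → Prop}
    (h : ∀ d, (∃ᶠ n in atTop, Q n d) → P d) :
    sInf {n : ℕ∞ | ∃ d : ℕ, n = d ∧ P d} ≤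
      liminf (fun i => sInf {n : ℕ∞ | ∃ d : ℕ, n = d ∧ Q i d}) atTop := by
  rcases eq_or_ne (liminf (fun i => sInf {n : ℕ∞ | ∃ d : ℕ, n = d ∧ Q i d}) atTop) ⊤ with
    htop | htop
  · rw [htop]
    exact le_top
  obtain ⟨N, hN⟩ := ENat.ne_top_iff_exists.1 htop
  rw [← hN, sInf_cast_le_iff]
  have hlt : liminf (fun i => sInf {n : ℕ∞ | ∃ d : ℕ, n = d ∧ Q i d}) atTop <
      ((N + 1 : ℕ) : ℕ∞) := by
    rw [← hN]
    exact_mod_cast N.lt_succ_self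
  have hfr : ∃ᶠ i in atTop, ∃ d ∈ Finset.range (N + 1), Q i d := by
    refine (frequently_lt_of_liminf_lt (by isBoundedDefault) hlt).mono fun i hi => ?_
    have hi' : sInf {n : ℕ∞ | ∃ d : ℕ, n = d ∧ Q i d} ≤ (N : ℕ) :=
      Order.le_of_lt_add_one (by exact_mod_cast hi)
    obtain ⟨d, hd, hQ⟩ := sInf_cast_le_iff.1 hi'
    exact ⟨d, Finset.mem_range.2 (Nat.lt_succ_of_le hd), hQ⟩
  by_contra hcon
  refine hfr ?_
  have : ∀ᶠ i in atTop, ∀ d ∈ Finset.range (N + 1), ¬ Q i d := by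
    rw [eventually_all_finset]
    intro d hd
    by_contra hq
    exact hcon ⟨d, Nat.le_of_lt_succ (Finset.mem_range.1 hd), h d hq⟩
  exact this.mono fun i hi ⟨d, hd, hQ⟩ => hi d hd hQ

variable {G : Type v} [Group G] [TopologicalSpace G] [IsTopologicalGroup G] [CompactSpace G]
  [SecondCountableTopology G] {L : Type u} [CStarAlgebra L] [Nontrivial L]
  [TopologicalSpace.SeparableSpace L] {α : CStarAction G L}
  {A : ℕ → Type w} [∀ n, CStarAlgebra (A n)] [∀ n, Nontrivial (A n)]
  {ι : ∀ n, A n →⋆ₐ[ℂ] A (n + 1)} {β : ∀ n, CStarAction G (A n)} {ιInf : ∀ n, A n →⋆ₐ[ℂ] L}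

omit [Nontrivial L] [TopologicalSpace.SeparableSpace L] [∀ n, Nontrivial (A n)] in
lemma IsCStarDirectLimit.range_subset (h : IsCStarDirectLimit ι ιInf) {n k : ℕ} (hnk : n ≤ k) :
    Set.range (ιInf n) ⊆ Set.range (ιInf k) := by
  induction k, hnk using Nat.le_induction with
  | base => exact subset_rfl
  | succ k _ ih =>
    refine ih.trans ?_
    rintro _ ⟨a, rfl⟩
    exact ⟨ι k a, h.compatible k a⟩

/-- Rokhlin systems for the actions on infinitely many of the building blocks, with the same number
of towers, produce one for the action on the direct limit. -/
lemma IsCStarDirectLimit.exists_isRokhlinSystem (h : IsCStarDirectLimit ι ιInf)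
    (hβ : ∀ n g a, α.toAut g (ιInf n a) = ιInf n ((β n).toAut g a)) {d : ℕ} {ν : ℕ → ℕ}
    (hν : ∀ k, k ≤ ν k) (φ : ∀ k, Fin (d + 1) → C(G, ℂ) →ₗ[ℂ] SeqAlg (A (ν k)))
    (hφ : ∀ k, IsRokhlinSystem (β (ν k)) (φ k)) :
    ∃ φ' : Fin (d + 1) → C(G, ℂ) →ₗ[ℂ] SeqAlg L, IsRokhlinSystem α φ' ∧
      ∀ j l, (∀ k f f', Commute (φ k j f) (φ k l f')) → ∀ f f', Commute (φ' j f) (φ' l f') := by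
  have hπ : ∀ n g a, ιInf n ((β n).hom g a) = α.hom g (ιInf n a) := fun n g a => (hβ n g a).symm
  obtain ⟨φ', h1, h2⟩ := exists_isRokhlinSystem_of_seq (α := α)
    (fun j k => (seqAlgMap (ιInf (ν k))).toAlgHom.toLinearMap ∘ₗ φ k j)
    (fun j k f => seqAlgMap_mem_contSeqAlg (hπ (ν k)) ((hφ k).mem j f).1)
    (fun j k => ((hφ k).cpcOrderZero j).comp_starAlgHom _)
    (fun j k g f => by
      change seqAlgMap _ (φ k j (leftTranslate g f)) = seqAlgMap _ (seqAlgMap _ (φ k j f))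
      rw [(hφ k).equivariant, seqAlgMap_equivariant (hπ (ν k))])
    (fun k => by
      change ∑ j, seqAlgMap (ιInf (ν k)) (φ k j 1) = 1
      rw [← map_sum, (hφ k).sum_one]
      exact (seqAlgMap (ιInf (ν k))).map_one') h.dense (fun j f a ha => by
      obtain ⟨n, hn⟩ := Set.mem_iUnion.1 ha
      filter_upwards [eventually_ge_atTop n] with k hk
      obtain ⟨b, rfl⟩ := h.range_subset (hk.trans (hν k)) hn
      exact commute_seqAlgMap_constSeq ((hφ k).mem j f).2 _ b)
  exact ⟨φ', h1, fun j l hjl => h2 j l fun k f f' =>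
    (hjl k f f').map (seqAlgMap (ιInf (ν k)))⟩

lemma IsCStarDirectLimit.dimRok_le_liminf (h : IsCStarDirectLimit ι ιInf)
    (hβ : ∀ n g a, α.toAut g (ιInf n a) = ιInf n ((β n).toAut g a)) :
    dimRok α ≤ liminf (fun n => dimRok (β n)) atTop := by
  refine sInf_cast_le_liminf fun d hd => ?_
  choose ν hν φ hφ using frequently_atTop.1 hd
  obtain ⟨φ', h1, -⟩ := h.exists_isRokhlinSystem hβ hν φ hφ
  exact ⟨φ', h1⟩

lemma IsCStarDirectLimit.dimRokComm_le_liminf (h : IsCStarDirectLimit ι ιInf)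
    (hβ : ∀ n g a, α.toAut g (ιInf n a) = ιInf n ((β n).toAut g a)) :
    dimRokComm α ≤ liminf (fun n => dimRokComm (β n)) atTop := by
  refine sInf_cast_le_liminf fun d hd => ?_
  choose ν hν φ hφ using frequently_atTop.1 hd
  obtain ⟨φ', h1, h2⟩ := h.exists_isRokhlinSystem hβ hν φ fun k => (hφ k).1
  exact ⟨φ', h1, fun j l hjl => h2 j l fun k => (hφ k).2 j l hjl⟩

end DirectLimit

end RokhlinDim

end

theorem theorem3p7
    {G : Type*} [Group G] [TopologicalSpace G] [IsTopologicalGroup G] [CompactSpace G] [T2Space G]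
    [SecondCountableTopology G]
    {A : Type*} [CStarAlgebra A] [Nontrivial A] (α : CStarAction G A) :
    -- (1) tensor products
    (∀ (B : Type*) [CStarAlgebra B] [Nontrivial B] (β : CStarAction G B)
        (C : Type*) [CStarAlgebra C] [Nontrivial C] (γ : CStarAction G C)
        (j : A ⊗[ℂ] B →⋆ₐ[ℂ] C),
        IsTensorProductAction α β γ j →
          dimRok γ ≤ min (dimRok α) (dimRok β) ∧
          dimRokComm γ ≤ min (dimRokComm α) (dimRokComm β)) ∧
    -- (2) quotients
    (∀ (I : Ideal A) [I.IsTwoSided] [IsClosed (I : Set A)] [Nontrivial (A ⧸ I)]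
        (hinv : ∀ g, ∀ a ∈ I, α.toAut g a ∈ I),
          dimRok (α.quotient I hinv) ≤ dimRok α ∧
          dimRokComm (α.quotient I hinv) ≤ dimRokComm α) ∧
    -- (3) direct limits
    (∀ (A' : ℕ → Type*) [∀ n, CStarAlgebra (A' n)] [∀ n, Nontrivial (A' n)]
        (ι : ∀ n, A' n →⋆ₐ[ℂ] A' (n + 1)) (α' : ∀ n, CStarAction G (A' n))
        (ιInf : ∀ n, A' n →⋆ₐ[ℂ] A),
        (∀ n g a, ι n ((α' n).toAut g a) = (α' (n + 1)).toAut g (ι n a)) →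
        IsCStarDirectLimit ι ιInf →
        (∀ n g a, α.toAut g (ιInf n a) = ιInf n ((α' n).toAut g a)) →
        TopologicalSpace.SeparableSpace A →
          dimRok α ≤ Filter.liminf (fun n => dimRok (α' n)) Filter.atTop ∧
          dimRokComm α ≤ Filter.liminf (fun n => dimRokComm (α' n)) Filter.atTop) := by
  refine ⟨?_, ?_, ?_⟩
  · intro B _ _ β C _ _ γ j h
    exact ⟨le_min
        (dimRok_le_of_map h.leftFactor_equivariant fun _ =>
          leftFactor_mem_relCommutant h.denseRange)
        (dimRok_le_of_map h.rightFactor_equivariant fun _ =>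
          rightFactor_mem_relCommutant h.denseRange),
      le_min
        (dimRokComm_le_of_map h.leftFactor_equivariant fun _ =>
          leftFactor_mem_relCommutant h.denseRange)
        (dimRokComm_le_of_map h.rightFactor_equivariant fun _ =>
          rightFactor_mem_relCommutant h.denseRange)⟩
  · intro I _ _ _ hinv
    exact ⟨dimRok_le_of_map (π := quotientHom I) (fun _ _ => rfl) fun _ =>
        quotientHom_mem_relCommutant I,
      dimRokComm_le_of_map (π := quotientHom I) (fun _ _ => rfl) fun _ =>
        quotientHom_mem_relCommutant I⟩
  · intro A' _ _ ι α' ιInf _ h hα _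
    exact ⟨h.dimRok_le_liminf hα, h.dimRokComm_le_liminf hα⟩
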